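/- For each $i\in\mathbb N$ let $G_i$ be the symmetric group $S_{n_i}$ or the alternating group $A_{n_i}$, acting primitively (in particular transitively) on a finite set $\Omega_i$ with $|\Omega_i|\ge 3$, and assume that $n_i\to\infty$. For $w\in G_i$ let $F_i(w)$ be the number of fixed points of $w$ on $\Omega_i$, let $d_i$ be the proportion of $w\in G_i$ with $F_i(w)=0$, and let the rank of $G_i$ on $\Omega_i$ be the number of orbits of $G_i$ on $\Omega_i\times\Omega_i$. Then the following are equivalent: 1. $\lim_{i\to\infty} d_i=1$; 2. there is no fixed $k$ such that, for infinitely many $i$, $\Omega_i$ is isomorphic as a $G_i$-set to the set of $k$-element subsets of $\{1,\dots,n_i\}$ with its natural action; 3. the rank of $G_i$ acting on $\Omega_i$ tends to $\infty$. Consequently, the only actions with a nontrivial limit law are those on $k$-sets with $k$ fixed: if, for $w\in G_i$ uniformly random, $F_i(w)$ converges in distribution as $i\to\infty$ to a probability law on $\{0,1,2,\dots\}$ other than the point mass at $0$, then there is a fixed $k$ such that for all sufficiently large $i$ the $G_i$-set $\Omega_i$ is isomorphic to the set of $k$-element subsets of $\{1,\dots,n_i\}$. -/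

import Mathlib

open Filter Topology

/-- The proportion of elements of `G` that fix exactly `j` points of `Ω`, i.e. the probability
that a uniformly random element of the finite group `G` has exactly `j` fixed points. -/
noncomputable def fixedPointLaw (G Ω : Type*) [Group G] [MulAction G Ω] (j : ℕ) : ℝ :=
  (Nat.card {w : G // Nat.card (MulAction.fixedBy Ω w) = j} : ℝ) / (Nat.card G : ℝ)

/-- The proportion of elements of `G` that have no fixed point on `Ω`. -/
noncomputable def derangementProportion (G Ω : Type*) [Group G] [MulAction G Ω] : ℝ :=
  (Nat.card {w : G // ∀ x : Ω, w • x ≠ x} : ℝ) / (Nat.card G : ℝ)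

/-- The rank of an action: the number of orbits of `G` on `Ω × Ω` for the diagonal action. -/
noncomputable def actionRank (G Ω : Type*) [Group G] [MulAction G Ω] : ℕ :=
  Nat.card (MulAction.orbitRel.Quotient G (Ω × Ω))

/-- `Ω` is, as a `G`-set, the set of `k`-element subsets of the `n` points on which the
permutation group `G` of degree `n` naturally acts. -/
def IsKSetAction {n : ℕ} (G : Subgroup (Equiv.Perm (Fin n))) (Ω : Type*) [MulAction G Ω]
    (k : ℕ) : Prop :=
  ∃ e : Ω →[G] Set.powersetCard (Fin n) k, Function.Bijective e

/-! ### Moments of cycle statistics of a random permutation. -/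

namespace Equiv.Perm

open Function

variable {α β : Type*} [Fintype α] [Fintype β]

/-! The core is a dichotomy, `exists_isKSetAction_or_derangementProportion_ge`: a primitive action
of large degree is on `k`-sets with `k` bounded, or almost every element is a derangement. An
element with a fixed point is conjugate into a point stabilizer `K`, viewed as a subgroup of `Perm
(Fin n)`. If `K` is intransitive, maximality makes it a set stabilizer, and the action is on
`k`-sets. If `K` is transitive, two facts about random permutations are used. First, preserving some
set of `k ≤ n / 2` points has probability `O(1 / log k)` (`card_exists_invariant_le`). Such a
permutation has typically twice the usual number of cycles of length at most `k`, since the set and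
its complement each supply a full share; Chebyshev's inequality makes this quantitative. Second,
almost every permutation has a power that is a cycle of large prime length at most `n / 2`
(`eventually_card_not_hasPrimeCyclePower_le`), by a second moment argument and Chebyshev's estimates
for primes. If `K` is primitive, a Jordan-type theorem would then force it to contain the
alternating group, which `|Ω| ≥ 3` forbids. If `K` is imprimitive, the cycle lies inside one block,
which is therefore large and invariant, and the first fact applies. The rank enters through moments:
the number of fixed points `F` has mean `1` and second moment equal to the rank, so Cauchy–Schwarz
bounds the proportion of elements with a fixed point below by `1 / rank`. On `k`-sets the rank is at
most `k + 1`, because pairs are classified by intersection size. For the limit law, the third moment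
is bounded on `k`-sets with `k` bounded, so truncated second moments nearly recover the rank `k +
1`; their convergence forces `k` to be eventually constant. -/

theorem minimalPeriod_pos (σ : Perm α) (x : α) : 0 < minimalPeriod σ x :=
  minimalPeriod_pos_of_mem_periodicPts <|
    Function.Injective.mem_periodicPts σ.injective x

theorem minimalPeriod_le_card (σ : Perm α) (x : α) : minimalPeriod σ x ≤ Fintype.card α := by
  have h := Fintype.card_le_of_injective (fun i : Fin (minimalPeriod σ x) => σ^[i] x) (by
    intro i j hij
    exact Fin.ext (iterate_injOn_Iio_minimalPeriod i.2 j.2 hij))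
  simpa using h

theorem apply_iterate_finRotate (σ : Perm α) (x : α) {l : ℕ} (hl : minimalPeriod σ x = l)
    (i : Fin l) : σ (σ^[i] x) = σ^[finRotate l i] x := by
  subst hl
  have := minimalPeriod_pos σ x
  obtain ⟨k, hk⟩ : ∃ k, minimalPeriod σ x = k + 1 := ⟨_, (Nat.succ_pred_eq_of_pos this).symm⟩
  rw [← Function.iterate_succ_apply' σ, ← iterate_mod_minimalPeriod_eq (n := i.1.succ)]
  congr 2
  generalize minimalPeriod σ x = l at *
  subst hk
  rw [finRotate_apply, Fin.val_add]
  simp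

variable [DecidableEq α]

/-- The number of permutations of `α` extending a given permutation of an embedded copy of `β`. -/
theorem card_extensions_le (τ : Perm β) (f : β ↪ α) :
    Fintype.card {σ : Perm α // ∀ b, σ (f b) = f (τ b)} ≤
      (Fintype.card α - Fintype.card β).factorial := by
  classical
  let p : α → Prop := fun a => a ∉ Set.range f
  have hcard : Fintype.card (Subtype p) = Fintype.card α - Fintype.card β := by
    have h1 : Fintype.card {a // ¬ (a ∈ Set.range f)} = Fintype.card α - Fintype.card β := by
      rw [Fintype.card_subtype_compl]
      congr 1
      exact (Fintype.card_congr (Equiv.ofInjective f f.injective)).symm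
    rw [← h1]
  rw [← hcard, ← Fintype.card_perm, Fintype.card_congr (Equiv.Perm.subtypeEquivSubtypePerm p)]
  -- Two extensions agree on the image of `f`, so dividing by one fixed extension leaves a
  -- permutation of the complement.
  refine Fintype.card_le_of_injective
    (fun σ => ⟨(τ.viaFintypeEmbedding f)⁻¹ * σ.1, ?_⟩) ?_
  · intro a ha
    obtain ⟨b, rfl⟩ : a ∈ Set.range f := by simpa [p] using ha
    rw [Perm.mul_apply, σ.2, ← viaFintypeEmbedding_apply_image]
    exact (τ.viaFintypeEmbedding f).symm_apply_apply _
  · intro σ σ' h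
    simpa [Subtype.ext_iff] using h

/-- On average, a permutation of `α` extends a given permutation of `β` along at most one
embedding of `β` in `α`. -/
theorem sum_card_equivariant_embeddings_le [DecidableEq β] (τ : Perm β) :
    ∑ σ : Perm α, Nat.card {f : β ↪ α // ∀ b, σ (f b) = f (τ b)} ≤
      (Fintype.card α).factorial := by
  have hswap : ∑ σ : Perm α, Nat.card {f : β ↪ α // ∀ b, σ (f b) = f (τ b)} =
      ∑ f : β ↪ α, Fintype.card {σ : Perm α // ∀ b, σ (f b) = f (τ b)} := by
    simp only [Nat.card_eq_fintype_card, Fintype.card_subtype, Finset.card_filter]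
    exact Finset.sum_comm
  rw [hswap]
  refine (Finset.sum_le_sum fun f _ => card_extensions_le τ f).trans ?_
  rw [Finset.sum_const, Finset.card_univ, Fintype.card_embedding_eq, smul_eq_mul]
  rcases le_or_gt (Fintype.card β) (Fintype.card α) with h | h
  · rw [mul_comm, Nat.factorial_mul_descFactorial h]
  · rw [Nat.descFactorial_eq_zero_iff_lt.2 h]
    simp

theorem sameCycle_iff_exists_iterate (σ : Perm α) (x y : α) :
    σ.SameCycle x y ↔ ∃ i < minimalPeriod σ x, σ^[i] x = y := by
  constructor
  · intro h
    obtain ⟨i, -, -, hi⟩ := h.exists_pow_eq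
    refine ⟨i % minimalPeriod σ x, Nat.mod_lt _ (minimalPeriod_pos σ x), ?_⟩
    rw [iterate_mod_minimalPeriod_eq, iterate_eq_pow, hi]
  · rintro ⟨i, -, hi⟩
    exact ⟨i, by rw [zpow_natCast, ← iterate_eq_pow, hi]⟩

theorem card_sameCycle (σ : Perm α) (x : α) :
    (Finset.univ.filter fun y => σ.SameCycle x y).card = minimalPeriod σ x := by
  have : (Finset.univ.filter fun y => σ.SameCycle x y) =
      (Finset.range (minimalPeriod σ x)).image fun i => σ^[i] x := by
    ext y
    simp [sameCycle_iff_exists_iterate]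
  rw [this, Finset.card_image_of_injOn, Finset.card_range]
  simpa [Set.InjOn] using (iterate_injOn_Iio_minimalPeriod (f := σ) (x := x))

theorem SameCycle.minimalPeriod_eq {σ : Perm α} {x y : α} (h : σ.SameCycle x y) :
    minimalPeriod σ x = minimalPeriod σ y := by
  rw [← card_sameCycle, ← card_sameCycle]
  congr 1
  ext z
  simp only [Finset.mem_filter, Finset.mem_univ, true_and]
  exact ⟨fun hz => h.symm.trans hz, fun hz => h.trans hz⟩

/-- A point `x` on an `l`-cycle gives the embedding `i ↦ σ^[i] x`, which intertwines `finRotate l`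
with `σ` and returns `x` at `0`. Counting points thus becomes counting equivariant embeddings, whose
average is at most one. -/
theorem card_minimalPeriod_eq_le (σ : Perm α) (l : ℕ) :
    (Finset.univ.filter fun x => minimalPeriod σ x = l).card ≤
      Nat.card {f : Fin l ↪ α // ∀ b, σ (f b) = f (finRotate l b)} := by
  rcases Nat.eq_zero_or_pos l with rfl | hl
  · rw [Finset.filter_false_of_mem fun x _ => (minimalPeriod_pos σ x).ne']
    simp
  rw [← Fintype.card_subtype, Nat.card_eq_fintype_card]
  refine Fintype.card_le_of_injective (fun x => ⟨⟨fun i => σ^[i] x.1, ?_⟩, ?_⟩) ?_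
  · intro i j hij
    exact Fin.ext (iterate_injOn_Iio_minimalPeriod (by simp [x.2]) (by simp [x.2]) hij)
  · intro i
    exact apply_iterate_finRotate σ x.1 x.2 i
  · intro x y hxy
    have := DFunLike.congr_fun (Subtype.ext_iff.1 hxy) ⟨0, hl⟩
    exact Subtype.ext this

theorem card_pairs_minimalPeriod_eq_le (σ : Perm α) (l l' : ℕ) :
    (Finset.univ.filter fun x : α × α => ¬ σ.SameCycle x.1 x.2 ∧
      minimalPeriod σ x.1 = l ∧ minimalPeriod σ x.2 = l').card ≤
      Nat.card {f : Fin l ⊕ Fin l' ↪ α //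
        ∀ b, σ (f b) = f (Equiv.sumCongr (finRotate l) (finRotate l') b)} := by
  rcases Nat.eq_zero_or_pos l with rfl | hl
  · rw [Finset.filter_false_of_mem fun x _ h => (minimalPeriod_pos σ x.1).ne' h.2.1]
    simp
  rcases Nat.eq_zero_or_pos l' with rfl | hl'
  · rw [Finset.filter_false_of_mem fun x _ h => (minimalPeriod_pos σ x.2).ne' h.2.2]
    simp
  rw [← Fintype.card_subtype, Nat.card_eq_fintype_card]
  refine Fintype.card_le_of_injective (fun x =>
    ⟨⟨Sum.elim (fun i => σ^[i] x.1.1) (fun i => σ^[i] x.1.2), ?_⟩, ?_⟩) ?_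
  · refine Function.Injective.sumElim ?_ ?_ ?_
    · intro i j hij
      exact Fin.ext (iterate_injOn_Iio_minimalPeriod (by simp [x.2.2.1]) (by simp [x.2.2.1]) hij)
    · intro i j hij
      exact Fin.ext (iterate_injOn_Iio_minimalPeriod (by simp [x.2.2.2]) (by simp [x.2.2.2]) hij)
    · intro i j hij
      apply x.2.1
      have h1 : σ.SameCycle x.1.1 (σ^[i] x.1.1) :=
        ⟨i.1, by rw [zpow_natCast, ← iterate_eq_pow]⟩
      have h2 : σ.SameCycle x.1.2 (σ^[j] x.1.2) :=
        ⟨j.1, by rw [zpow_natCast, ← iterate_eq_pow]⟩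
      rw [hij] at h1
      exact h1.trans h2.symm
  · rintro (i | i)
    · exact apply_iterate_finRotate σ x.1.1 x.2.2.1 i
    · exact apply_iterate_finRotate σ x.1.2 x.2.2.2 i
  · intro x y hxy
    have h1 := DFunLike.congr_fun (Subtype.ext_iff.1 hxy) (Sum.inl ⟨0, hl⟩)
    have h2 := DFunLike.congr_fun (Subtype.ext_iff.1 hxy) (Sum.inr ⟨0, hl'⟩)
    exact Subtype.ext (Prod.ext h1 h2)

theorem sum_card_minimalPeriod_eq_le (l : ℕ) :
    ∑ σ : Perm α, (Finset.univ.filter fun x => minimalPeriod σ x = l).card ≤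
      (Fintype.card α).factorial :=
  (Finset.sum_le_sum fun σ _ => card_minimalPeriod_eq_le σ l).trans
    (sum_card_equivariant_embeddings_le _)

theorem sum_card_pairs_minimalPeriod_eq_le (l l' : ℕ) :
    ∑ σ : Perm α, (Finset.univ.filter fun x : α × α => ¬ σ.SameCycle x.1 x.2 ∧
      minimalPeriod σ x.1 = l ∧ minimalPeriod σ x.2 = l').card ≤
      (Fintype.card α).factorial :=
  (Finset.sum_le_sum fun σ _ => card_pairs_minimalPeriod_eq_le σ l l').trans
    (sum_card_equivariant_embeddings_le _)

/-- For each length `1 ≤ l ≤ n`, the average number of points on cycles of length `l` is `1`. -/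
theorem sum_card_minimalPeriod_eq {l : ℕ} (hl : l ∈ Finset.Icc 1 (Fintype.card α)) :
    ∑ σ : Perm α, (Finset.univ.filter fun x => minimalPeriod σ x = l).card =
      (Fintype.card α).factorial := by
  have htot : ∑ l ∈ Finset.Icc 1 (Fintype.card α), ∑ σ : Perm α,
      (Finset.univ.filter fun x => minimalPeriod σ x = l).card =
      ∑ l ∈ Finset.Icc 1 (Fintype.card α), (Fintype.card α).factorial := by
    rw [Finset.sum_comm]
    have : ∀ σ : Perm α, ∑ l ∈ Finset.Icc 1 (Fintype.card α),
        (Finset.univ.filter fun x => minimalPeriod σ x = l).card = Fintype.card α := by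
      intro σ
      rw [← Finset.card_univ (α := α)]
      refine (Finset.card_eq_sum_card_fiberwise fun x _ => ?_).symm
      simpa using ⟨minimalPeriod_pos σ x, minimalPeriod_le_card σ x⟩
    simp only [this]
    simp [Fintype.card_perm, mul_comm]
  -- Every term is at most `n!` and the totals agree, so equality holds termwise.
  exact (Finset.sum_eq_sum_iff_of_le fun l _ => sum_card_minimalPeriod_eq_le l).1 htot l hl

/-- The average of a nonnegative statistic of pairs of points on distinct cycles. -/
theorem sum_pairs_minimalPeriod_le (W : ℕ → ℕ → ℝ) (hW : ∀ l l', 0 ≤ W l l') :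
    ∑ σ : Perm α, ∑ x : α × α, (if σ.SameCycle x.1 x.2 then 0 else
      W (minimalPeriod σ x.1) (minimalPeriod σ x.2)) ≤
    (Fintype.card α).factorial * ∑ l ∈ Finset.Icc 1 (Fintype.card α),
      ∑ l' ∈ Finset.Icc 1 (Fintype.card α), W l l' := by
  set I := Finset.Icc 1 (Fintype.card α) with hI
  have hmem : ∀ (σ : Perm α) x, minimalPeriod σ x ∈ I := fun σ x => by
    simpa [hI] using ⟨minimalPeriod_pos σ x, minimalPeriod_le_card σ x⟩
  have hexp : ∀ σ : Perm α, ∑ x : α × α, (if σ.SameCycle x.1 x.2 then 0 else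
      W (minimalPeriod σ x.1) (minimalPeriod σ x.2)) =
      ∑ l ∈ I, ∑ l' ∈ I, W l l' * ((Finset.univ.filter fun x : α × α => ¬ σ.SameCycle x.1 x.2 ∧
      minimalPeriod σ x.1 = l ∧ minimalPeriod σ x.2 = l').card : ℝ) := by
    intro σ
    have : ∀ x : α × α, (if σ.SameCycle x.1 x.2 then 0 else
      W (minimalPeriod σ x.1) (minimalPeriod σ x.2)) = ∑ l ∈ I, ∑ l' ∈ I, W l l' *
        (if ¬ σ.SameCycle x.1 x.2 ∧
          minimalPeriod σ x.1 = l ∧ minimalPeriod σ x.2 = l' then (1 : ℝ) else 0) := by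
      intro x
      rw [Finset.sum_eq_single_of_mem _ (hmem σ x.1), Finset.sum_eq_single_of_mem _ (hmem σ x.2)]
      · by_cases h : σ.SameCycle x.1 x.2 <;> simp [h]
      · intro b _ hb
        simp [hb.symm]
      · intro b _ hb
        simp [hb.symm]
    simp only [this]
    rw [Finset.sum_comm]
    refine Finset.sum_congr rfl fun l _ => ?_
    rw [Finset.sum_comm]
    refine Finset.sum_congr rfl fun l' _ => ?_
    rw [← Finset.mul_sum, Finset.sum_boole]
  simp only [hexp]
  rw [Finset.sum_comm, Finset.mul_sum]
  refine Finset.sum_le_sum fun l _ => ?_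
  rw [Finset.sum_comm, Finset.mul_sum]
  refine Finset.sum_le_sum fun l' _ => ?_
  rw [← Finset.mul_sum, mul_comm]
  refine mul_le_mul_of_nonneg_right ?_ (hW l l')
  exact_mod_cast sum_card_pairs_minimalPeriod_eq_le l l'

/-- The number of cycles of `σ` (fixed points included) whose length belongs to `L`. -/
noncomputable def cycleCount (L : Finset ℕ) (σ : Perm α) : ℝ :=
  ∑ x, if minimalPeriod σ x ∈ L then (minimalPeriod σ x : ℝ)⁻¹ else 0

theorem sum_cycleCount {L : Finset ℕ} (hL : L ⊆ Finset.Icc 1 (Fintype.card α)) :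
    ∑ σ : Perm α, cycleCount L σ = (Fintype.card α).factorial * ∑ l ∈ L, (l : ℝ)⁻¹ := by
  have : ∀ σ : Perm α, cycleCount L σ = ∑ l ∈ L, (l : ℝ)⁻¹ *
      ((Finset.univ.filter fun x => minimalPeriod σ x = l).card : ℝ) := by
    intro σ
    simp only [cycleCount, ← Finset.sum_boole, Finset.mul_sum]
    rw [Finset.sum_comm]
    refine Finset.sum_congr rfl fun x _ => ?_
    simp
  simp only [this]
  rw [Finset.sum_comm, Finset.mul_sum]
  refine Finset.sum_congr rfl fun l hl => ?_
  rw [← Finset.mul_sum, mul_comm]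
  congr 1
  exact_mod_cast sum_card_minimalPeriod_eq (hL hl)

/-- The square is a sum over pairs of points. Pairs on a common cycle of length `l` number `l ^ 2`
with weight `l⁻²`, giving back `cycleCount`; pairs on distinct cycles average at most the square of
the mean. Hence the variance is at most the mean. -/
theorem sum_cycleCount_sq_le {L : Finset ℕ} (hL : L ⊆ Finset.Icc 1 (Fintype.card α)) :
    ∑ σ : Perm α, cycleCount L σ ^ 2 ≤ (Fintype.card α).factorial *
      ((∑ l ∈ L, (l : ℝ)⁻¹) ^ 2 + ∑ l ∈ L, (l : ℝ)⁻¹) := by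
  set u : ℕ → ℝ := fun l => if l ∈ L then (l : ℝ)⁻¹ else 0 with hu
  have hu0 : ∀ l, 0 ≤ u l := fun l => by simp only [hu]; split_ifs <;> positivity
  have hsplit : ∀ σ : Perm α, cycleCount L σ ^ 2 =
      (∑ x : α × α, if σ.SameCycle x.1 x.2 then 0 else
        u (minimalPeriod σ x.1) * u (minimalPeriod σ x.2)) + cycleCount L σ := by
    intro σ
    have h1 : cycleCount L σ ^ 2 =
        ∑ x : α × α, u (minimalPeriod σ x.1) * u (minimalPeriod σ x.2) := by
      rw [sq, cycleCount, Finset.sum_mul_sum, Fintype.sum_prod_type]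
    have h2 : cycleCount L σ = ∑ x : α × α, if σ.SameCycle x.1 x.2 then
        u (minimalPeriod σ x.1) * u (minimalPeriod σ x.2) else 0 := by
      rw [Fintype.sum_prod_type, cycleCount]
      refine Finset.sum_congr rfl fun x _ => ?_
      rw [← Finset.sum_filter]
      have : ∀ y ∈ Finset.univ.filter (fun y => σ.SameCycle x y),
          u (minimalPeriod σ x) * u (minimalPeriod σ y) = u (minimalPeriod σ x) ^ 2 := by
        intro y hy
        rw [← (SameCycle.minimalPeriod_eq (Finset.mem_filter.1 hy).2), sq]
      rw [Finset.sum_congr rfl this, Finset.sum_const, card_sameCycle, nsmul_eq_mul]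
      have hpos : (minimalPeriod σ x : ℝ) ≠ 0 := by exact_mod_cast (minimalPeriod_pos σ x).ne'
      simp only [hu]
      split_ifs
      · field_simp
      · simp
    conv_lhs => rw [h1]
    conv_rhs => rw [h2]
    rw [← Finset.sum_add_distrib]
    refine Finset.sum_congr rfl fun x _ => ?_
    split_ifs <;> simp
  have hsum : ∑ l ∈ Finset.Icc 1 (Fintype.card α), u l = ∑ l ∈ L, (l : ℝ)⁻¹ := by
    rw [← Finset.sum_filter, Finset.filter_mem_eq_inter, Finset.inter_eq_right.2 hL]
  simp only [hsplit]
  rw [Finset.sum_add_distrib, sum_cycleCount hL, mul_add]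
  refine add_le_add_left ?_ _
  refine (sum_pairs_minimalPeriod_le (fun l l' => u l * u l')
    fun l l' => mul_nonneg (hu0 l) (hu0 l')).trans_eq ?_
  rw [← Finset.sum_mul_sum, hsum, sq]

theorem sum_cycleCount_sub_sq_le {L : Finset ℕ} (hL : L ⊆ Finset.Icc 1 (Fintype.card α)) :
    ∑ σ : Perm α, (cycleCount L σ - ∑ l ∈ L, (l : ℝ)⁻¹) ^ 2 ≤
      (Fintype.card α).factorial * ∑ l ∈ L, (l : ℝ)⁻¹ := by
  set h := ∑ l ∈ L, (l : ℝ)⁻¹ with hh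
  have h1 := sum_cycleCount hL
  have h2 := sum_cycleCount_sq_le hL
  rw [← hh] at h1 h2
  have : ∑ σ : Perm α, (cycleCount L σ - h) ^ 2 =
      ∑ σ : Perm α, cycleCount L σ ^ 2 - 2 * h * ∑ σ : Perm α, cycleCount L σ
        + (Fintype.card α).factorial * h ^ 2 := by
    have : ∀ σ : Perm α, (cycleCount L σ - h) ^ 2 =
      cycleCount L σ ^ 2 - 2 * h * cycleCount L σ + h ^ 2 := fun σ => by ring
    simp only [this]
    rw [Finset.sum_add_distrib, Finset.sum_sub_distrib, ← Finset.mul_sum]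
    simp [Fintype.card_perm]
  rw [this, h1]
  linarith

/-- Chebyshev's inequality for the number of cycles with length in `L`. -/
theorem card_cycleCount_deviation_le {L : Finset ℕ} (hL : L ⊆ Finset.Icc 1 (Fintype.card α))
    {t : ℝ} (ht : 0 ≤ t) :
    ((Finset.univ.filter fun σ : Perm α =>
      t ≤ |cycleCount L σ - ∑ l ∈ L, (l : ℝ)⁻¹|).card : ℝ) * t ^ 2 ≤
      (Fintype.card α).factorial * ∑ l ∈ L, (l : ℝ)⁻¹ := by
  refine le_trans ?_ (sum_cycleCount_sub_sq_le hL)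
  rw [← nsmul_eq_mul, ← Finset.sum_const]
  refine (Finset.sum_le_sum fun σ hσ => ?_).trans
    (Finset.sum_le_sum_of_subset_of_nonneg (Finset.filter_subset _ _) fun _ _ _ => sq_nonneg _)
  rw [← sq_abs (cycleCount L σ - _)]
  exact pow_le_pow_left₀ ht (Finset.mem_filter.1 hσ).2 2

end Equiv.Perm

/-! ### Permutations preserving a set of given size. -/

namespace Equiv.Perm

open Function

variable {α : Type*}
theorem minimalPeriod_subtypePerm {p : α → Prop} (σ : Perm α) (h : ∀ x, p (σ x) ↔ p x)
    (x : {x // p x}) : minimalPeriod (σ.subtypePerm h) x = minimalPeriod σ x := by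
  rw [minimalPeriod_eq_minimalPeriod_iff]
  intro n
  have : ∀ n, (((σ.subtypePerm h)^[n] x : {x // p x}) : α) = σ^[n] x := by
    intro n
    induction n with
    | zero => rfl
    | succ n ih => rw [iterate_succ_apply', iterate_succ_apply', ← ih]; rfl
  rw [IsPeriodicPt, IsPeriodicPt, IsFixedPt, IsFixedPt, ← this, Subtype.ext_iff]

theorem cycleCount_eq_add [Fintype α] (L : Finset ℕ) {p : α → Prop} [Fintype {x // p x}]
    [Fintype {x // ¬ p x}] (σ : Perm α)
    (h : ∀ x, p (σ x) ↔ p x) :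
    cycleCount L σ = cycleCount L (σ.subtypePerm h) +
      cycleCount L (σ.subtypePerm (p := fun x => ¬ p x) fun x => not_congr (h x)) := by
  simp only [cycleCount, minimalPeriod_subtypePerm]
  classical
  rw [← Fintype.sum_subtype_add_sum_subtype p
    (fun x => if minimalPeriod σ x ∈ L then (minimalPeriod σ x : ℝ)⁻¹ else 0)]
  congr 1 <;> exact Finset.sum_congr (by ext; simp) fun _ _ => rfl

variable [Fintype α] [DecidableEq α]

/-- The number of permutations preserving a set of `k ≤ n / 2` points and having few cycles of
length at most `k`. -/
theorem card_invariant_few_cycles_le {k : ℕ} (hk : 1 ≤ k) (hk2 : 2 * k ≤ Fintype.card α)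
    (S : Finset α) (hS : S.card = k) :
    ((Finset.univ.filter fun σ : Perm α => (∀ x, σ x ∈ S ↔ x ∈ S) ∧
      cycleCount (Finset.Icc 1 k) σ < 3 / 2 * ∑ l ∈ Finset.Icc 1 k, (l : ℝ)⁻¹).card : ℝ) *
      (∑ l ∈ Finset.Icc 1 k, (l : ℝ)⁻¹) ≤
      32 * ((k.factorial : ℝ) * (Fintype.card α - k).factorial) := by
  set L := Finset.Icc 1 k
  set h := ∑ l ∈ L, (l : ℝ)⁻¹ with hh
  have hpos : 0 < h := Finset.sum_pos (fun l hl => by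
    have := (Finset.mem_Icc.1 hl).1
    positivity) ⟨1, by simp [L, hk]⟩
  have hc1 : Fintype.card {x // x ∈ S} = k := by simp [hS]
  have hc2 : Fintype.card {x // ¬ x ∈ S} = Fintype.card α - k := by
    rw [Fintype.card_subtype_compl, hc1]
  -- Both restrictions of `σ` have mean `h`, as `k` is at most the size of either side. A total
  -- below `3h / 2` instead of `2h` forces one of them to deviate by at least `h / 4`, each with
  -- probability at most `16 / h`.
  let A : Finset (Perm {x // x ∈ S}) := Finset.univ.filter fun τ => h / 4 ≤ |cycleCount L τ - h|
  let B : Finset (Perm {x // ¬ x ∈ S}) := Finset.univ.filter fun τ => h / 4 ≤ |cycleCount L τ - h|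
  have hA : (A.card : ℝ) * (h / 4) ^ 2 ≤ k.factorial * h := by
    have := card_cycleCount_deviation_le (α := {x // x ∈ S}) (L := L)
      (by rw [hc1]) (t := h / 4) (by positivity)
    rwa [hc1] at this
  have hB : (B.card : ℝ) * (h / 4) ^ 2 ≤ (Fintype.card α - k).factorial * h := by
    have := card_cycleCount_deviation_le (α := {x // ¬ x ∈ S}) (L := L)
      (by rw [hc2]; exact Finset.Icc_subset_Icc_right (by omega)) (t := h / 4) (by positivity)
    rwa [hc2] at this
  have hle : (Finset.univ.filter fun σ : Perm α => (∀ x, σ x ∈ S ↔ x ∈ S) ∧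
      cycleCount L σ < 3 / 2 * h).card ≤
      (A ×ˢ (Finset.univ : Finset (Perm {x // ¬ x ∈ S})) ∪
        (Finset.univ : Finset (Perm {x // x ∈ S})) ×ˢ B).card := by
    refine Finset.card_le_card_of_injOn (fun σ => if hσ : ∀ x, σ x ∈ S ↔ x ∈ S then
      (σ.subtypePerm hσ, σ.subtypePerm (p := fun x => ¬ x ∈ S) fun x => not_congr (hσ x))
      else 1) ?_ ?_
    · intro σ hσ
      obtain ⟨hσ, hlt⟩ := (Finset.mem_filter.1 hσ).2
      rw [cycleCount_eq_add L σ hσ] at hlt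
      simp only [hσ, implies_true, ↓reduceDIte, Finset.coe_union, Finset.coe_product, Set.mem_union,
        Set.mem_prod, Finset.coe_univ, Set.mem_univ, and_true, true_and, Finset.mem_coe]
      by_contra hcon
      push Not at hcon
      have h1 := hcon.1
      have h2 := hcon.2
      simp only [A, B, Finset.mem_filter, Finset.mem_univ, true_and, not_le] at h1 h2
      rw [abs_lt] at h1 h2
      linarith
    · intro σ hσ σ' hσ' heq
      have hσ := (Finset.mem_filter.1 hσ).2.1
      have hσ' := (Finset.mem_filter.1 hσ').2.1
      simp only [hσ, hσ', implies_true, ↓reduceDIte, Prod.mk.injEq] at heq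
      ext x
      by_cases hx : x ∈ S
      · exact congrArg Subtype.val (DFunLike.congr_fun heq.1 ⟨x, hx⟩)
      · exact congrArg Subtype.val (DFunLike.congr_fun heq.2 ⟨x, hx⟩)
  have hle2 : ((Finset.univ.filter fun σ : Perm α => (∀ x, σ x ∈ S ↔ x ∈ S) ∧
      cycleCount L σ < 3 / 2 * h).card : ℝ) ≤
      A.card * (Fintype.card α - k).factorial + k.factorial * B.card := by
    have := hle.trans (Finset.card_union_le _ _)
    rw [Finset.card_product, Finset.card_product, Finset.card_univ, Finset.card_univ,
      Fintype.card_perm, Fintype.card_perm, hc1, hc2] at this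
    exact_mod_cast this
  have hA' : (A.card : ℝ) * h ≤ 16 * k.factorial := by
    refine le_of_mul_le_mul_right ?_ hpos
    nlinarith
  have hB' : (B.card : ℝ) * h ≤ 16 * (Fintype.card α - k).factorial := by
    refine le_of_mul_le_mul_right ?_ hpos
    nlinarith
  have hf1 : (0 : ℝ) ≤ k.factorial := by positivity
  have hf2 : (0 : ℝ) ≤ (Fintype.card α - k).factorial := by positivity
  have e1 := mul_le_mul_of_nonneg_right hA' hf2
  have e2 := mul_le_mul_of_nonneg_left hB' hf1
  have e3 := mul_le_mul_of_nonneg_right hle2 hpos.le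
  linarith

/-- The proportion of permutations of `n` points preserving some set of `k ≤ n / 2` points is
at most `36 / (1 + 1/2 + ... + 1/k)`. -/
theorem card_exists_invariant_le {k : ℕ} (hk : 1 ≤ k) (hk2 : 2 * k ≤ Fintype.card α) :
    (Nat.card {σ : Perm α // ∃ S : Finset α, S.card = k ∧ ∀ x, σ x ∈ S ↔ x ∈ S} : ℝ) *
      (∑ l ∈ Finset.Icc 1 k, (l : ℝ)⁻¹) ≤ 36 * (Fintype.card α).factorial := by
  rw [Nat.card_eq_fintype_card, Fintype.card_subtype]
  set L := Finset.Icc 1 k with hL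
  set h := ∑ l ∈ L, (l : ℝ)⁻¹ with hh
  have hpos : 0 < h := Finset.sum_pos (fun l hl => by
    have := (Finset.mem_Icc.1 hl).1
    positivity) ⟨1, by simp [L, hk]⟩
  -- Having at least `3h / 2` short cycles has probability at most `4 / h`. Otherwise a union bound
  -- over the `n.choose k` sets costs `32 / h`; together these give `36 / h`.
  set A := Finset.univ.filter fun σ : Perm α => h / 2 ≤ |cycleCount L σ - h|
  set B : Finset α → Finset (Perm α) := fun S => Finset.univ.filter fun σ : Perm α =>
    (∀ x, σ x ∈ S ↔ x ∈ S) ∧ cycleCount L σ < 3 / 2 * h with hB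
  have hA : (A.card : ℝ) * (h / 2) ^ 2 ≤ (Fintype.card α).factorial * h :=
    card_cycleCount_deviation_le (Finset.Icc_subset_Icc_right (by omega)) (by positivity)
  have hA' : (A.card : ℝ) * h ≤ 4 * (Fintype.card α).factorial := by
    refine le_of_mul_le_mul_right ?_ hpos
    nlinarith
  have hsub : (Finset.univ.filter fun σ : Perm α =>
      ∃ S : Finset α, S.card = k ∧ ∀ x, σ x ∈ S ↔ x ∈ S) ⊆
      A ∪ (Finset.univ.powersetCard k).biUnion B := by
    intro σ hσ
    obtain ⟨S, hS, hσS⟩ := (Finset.mem_filter.1 hσ).2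
    by_cases hlt : cycleCount L σ < 3 / 2 * h
    · refine Finset.mem_union_right _ (Finset.mem_biUnion.2 ⟨S, ?_, ?_⟩)
      · exact Finset.mem_powersetCard_univ.2 hS
      · simp only [hB, Finset.mem_filter, Finset.mem_univ, true_and]
        exact ⟨hσS, hlt⟩
    · refine Finset.mem_union_left _ (Finset.mem_filter.2 ⟨Finset.mem_univ _, ?_⟩)
      rw [le_abs]
      left
      linarith
  have hcard := (Finset.card_le_card hsub).trans ((Finset.card_union_le _ _).trans
    (Nat.add_le_add_left Finset.card_biUnion_le _))
  have hcard' : ((Finset.univ.filter fun σ : Perm α =>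
      ∃ S : Finset α, S.card = k ∧ ∀ x, σ x ∈ S ↔ x ∈ S).card : ℝ) ≤
      A.card + ∑ S ∈ Finset.univ.powersetCard k, ((B S).card : ℝ) := by exact_mod_cast hcard
  have hsum : (∑ S ∈ Finset.univ.powersetCard k, ((B S).card : ℝ)) * h ≤
      32 * (Fintype.card α).factorial := by
    rw [Finset.sum_mul]
    refine (Finset.sum_le_sum fun S hS => card_invariant_few_cycles_le hk hk2 S
      (Finset.mem_powersetCard_univ.1 hS)).trans_eq ?_
    rw [Finset.sum_const, Finset.card_powersetCard, Finset.card_univ, nsmul_eq_mul]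
    have := Nat.choose_mul_factorial_mul_factorial (n := Fintype.card α) (k := k) (by omega)
    rw [← this]
    push_cast
    ring
  have := mul_le_mul_of_nonneg_right hcard' hpos.le
  linarith

end Equiv.Perm

/-! ### Permutations with a power that is a cycle of prime length. -/

namespace Equiv.Perm

open Function

variable {α : Type*}

theorem iterate_eq_of_modEq {σ : Perm α} {x : α} {i j : ℕ}
    (h : i ≡ j [MOD minimalPeriod σ x]) : σ^[i] x = σ^[j] x := by
  rw [← iterate_mod_minimalPeriod_eq (n := i), ← iterate_mod_minimalPeriod_eq (n := j), h]

variable [Fintype α] [DecidableEq α]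

/-- A cycle of `σ` whose length is coprime to the lengths of all the other cycles is a power
of `σ`. -/
theorem cycleOf_mem_zpowers {σ : Perm α} {x : α}
    (h : ∀ y, ¬ σ.SameCycle x y → (minimalPeriod σ x).Coprime (minimalPeriod σ y)) :
    σ.cycleOf x ∈ Subgroup.zpowers σ := by
  set r := ∏ y ∈ Finset.univ.filter (fun y => ¬ σ.SameCycle x y), minimalPeriod σ y with hr
  have hco : (minimalPeriod σ x).Coprime r :=
    Nat.Coprime.prod_right fun y hy => h y (Finset.mem_filter.1 hy).2
  obtain ⟨s, hs1, hs2⟩ := Nat.chineseRemainder hco 1 0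
  refine ⟨s, ?_⟩
  ext y
  simp only [zpow_natCast, ← iterate_eq_pow, cycleOf_apply]
  split_ifs with hy
  · rw [hy.minimalPeriod_eq] at hs1
    exact iterate_eq_of_modEq hs1
  · have hdvd : minimalPeriod σ y ∣ r := Finset.dvd_prod_of_mem _ (by simpa using hy)
    exact iterate_eq_of_modEq (j := 0) (hs2.of_dvd hdvd)

theorem isCycle_cycleOf_of_one_lt {σ : Perm α} {x : α} (h : 1 < minimalPeriod σ x) :
    (σ.cycleOf x).IsCycle := by
  refine isCycle_cycleOf σ fun hx => ?_
  rw [(minimalPeriod_eq_one_iff_isFixedPt.2 hx)] at h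
  exact lt_irrefl _ h

theorem card_support_cycleOf_eq {σ : Perm α} {x : α} (h : 1 < minimalPeriod σ x) :
    (σ.cycleOf x).support.card = minimalPeriod σ x := by
  rw [← card_sameCycle]
  congr 1
  ext y
  have hx : x ∈ σ.support := by
    rw [mem_support]
    intro hx
    rw [(minimalPeriod_eq_one_iff_isFixedPt.2 hx)] at h
    exact lt_irrefl _ h
  rw [mem_support_cycleOf_iff]
  simp only [hx, and_true, Finset.mem_filter, Finset.mem_univ, true_and]

/-- Some power of `σ` is a cycle of prime length in the interval `[a, b]`. -/
def HasPrimeCyclePower (a b : ℕ) (σ : Perm α) : Prop :=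
  ∃ c ∈ Subgroup.zpowers σ, c.IsCycle ∧ c.support.card.Prime ∧
    a ≤ c.support.card ∧ c.support.card ≤ b

theorem HasPrimeCyclePower.conj {a b : ℕ} {σ : Perm α} (h : HasPrimeCyclePower a b σ)
    (g : Perm α) : HasPrimeCyclePower a b (g * σ * g⁻¹) := by
  obtain ⟨c, ⟨i, rfl⟩, hc, hp, ha, hb⟩ := h
  refine ⟨g * σ ^ i * g⁻¹, ⟨i, by simp [conj_zpow]⟩, hc.conj, ?_⟩
  rw [card_support_conj]
  exact ⟨hp, ha, hb⟩

theorem _root_.Nat.sum_multiples_inv_le {p m : ℕ} (hp : 0 < p) :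
    ∑ l ∈ Finset.Icc 1 m, (if p ∣ l then (p : ℝ)⁻¹ * (l : ℝ)⁻¹ else 0) ≤
      ((p : ℝ) ^ 2)⁻¹ * ∑ j ∈ Finset.Icc 1 m, (j : ℝ)⁻¹ := by
  rw [← Finset.sum_filter, Finset.mul_sum]
  have : ∀ l ∈ (Finset.Icc 1 m).filter (p ∣ ·), (p : ℝ)⁻¹ * (l : ℝ)⁻¹ =
      ((p : ℝ) ^ 2)⁻¹ * ((l / p : ℕ) : ℝ)⁻¹ := by
    intro l hl
    obtain ⟨j, rfl⟩ := (Finset.mem_filter.1 hl).2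
    rw [Nat.mul_div_cancel_left _ hp]
    push_cast
    rw [mul_inv]
    ring
  rw [Finset.sum_congr rfl this]
  have hinj : Set.InjOn (fun l => l / p) ((Finset.Icc 1 m).filter (p ∣ ·)) := by
    intro l hl l' hl' he
    obtain ⟨j, rfl⟩ := (Finset.mem_filter.1 hl).2
    obtain ⟨j', rfl⟩ := (Finset.mem_filter.1 hl').2
    simp only [Nat.mul_div_cancel_left _ hp] at he
    rw [he]
  rw [← Finset.sum_image (f := fun j : ℕ => ((p : ℝ) ^ 2)⁻¹ * (j : ℝ)⁻¹) hinj]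
  refine Finset.sum_le_sum_of_subset_of_nonneg ?_ fun _ _ _ => by positivity
  intro j hj
  obtain ⟨l, hl, rfl⟩ := Finset.mem_image.1 hj
  obtain ⟨hl, j, rfl⟩ := Finset.mem_filter.1 hl
  rw [Finset.mem_Icc] at hl
  simp only [Nat.mul_div_cancel_left _ hp, Finset.mem_Icc]
  refine ⟨Nat.pos_of_ne_zero fun h => by simp [h] at hl, ?_⟩
  exact (Nat.le_mul_of_pos_left j hp).trans hl.2

/-- Second moment bound for the number of permutations without a power that is a cycle of prime
length in a given set `P` of primes. -/
theorem card_not_hasPrimeCyclePower_le {a b : ℕ} {P : Finset ℕ} (hP : ∀ p ∈ P, p.Prime)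
    (ha : ∀ p ∈ P, a ≤ p) (hb : ∀ p ∈ P, p ≤ b) (hbm : b ≤ Fintype.card α)
    (hpos : 0 < ∑ p ∈ P, (p : ℝ)⁻¹) :
    (Nat.card {σ : Perm α // ¬ HasPrimeCyclePower a b σ} : ℝ) ≤ (Fintype.card α).factorial *
      ((∑ p ∈ P, (p : ℝ)⁻¹)⁻¹ +
        (∑ j ∈ Finset.Icc 1 (Fintype.card α), (j : ℝ)⁻¹) * ∑ p ∈ P, ((p : ℝ) ^ 2)⁻¹) := by
  classical
  set h := ∑ p ∈ P, (p : ℝ)⁻¹ with hh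
  set m := Fintype.card α with hm
  have hPsub : P ⊆ Finset.Icc 1 m := fun p hp =>
    Finset.mem_Icc.2 ⟨(hP p hp).one_le, (hb p hp).trans hbm⟩
  -- With these weights `Q` counts ordered pairs of distinct cycles, the first of length `p ∈ P`
  -- dividing the length of the second. If a cycle has length in `P` but no prime cycle power
  -- exists, such a pair occurs and Markov's inequality applies; if no cycle has length in `P`, then
  -- `cycleCount P` is `0` and Chebyshev's inequality applies.
  set W : ℕ → ℕ → ℝ := fun l l' => if l ∈ P then
    (if l ∣ l' then (l : ℝ)⁻¹ * (l' : ℝ)⁻¹ else 0) else 0 with hW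
  have hW0 : ∀ l l', 0 ≤ W l l' := fun l l' => by
    simp only [hW]; split_ifs <;> positivity
  set Q : Perm α → ℝ := fun σ => ∑ x : α × α, (if σ.SameCycle x.1 x.2 then 0 else
      W (minimalPeriod σ x.1) (minimalPeriod σ x.2)) with hQ
  have hterm0 : ∀ (σ : Perm α) (x : α × α), 0 ≤ (if σ.SameCycle x.1 x.2 then 0 else
      W (minimalPeriod σ x.1) (minimalPeriod σ x.2)) := fun σ x => by
    split_ifs
    · exact le_rfl
    · exact hW0 _ _
  have hQ0 : ∀ σ, 0 ≤ Q σ := fun σ => Finset.sum_nonneg fun x _ => hterm0 σ x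
  have hQsum : ∑ σ, Q σ ≤ m.factorial *
      ((∑ j ∈ Finset.Icc 1 m, (j : ℝ)⁻¹) * ∑ p ∈ P, ((p : ℝ) ^ 2)⁻¹) := by
    refine (sum_pairs_minimalPeriod_le W hW0).trans ?_
    refine mul_le_mul_of_nonneg_left ?_ (by positivity)
    rw [mul_comm, Finset.sum_mul]
    have : ∀ l ∈ Finset.Icc 1 m, ∑ l' ∈ Finset.Icc 1 m, W l l' = if l ∈ P then
        ∑ l' ∈ Finset.Icc 1 m, (if l ∣ l' then (l : ℝ)⁻¹ * (l' : ℝ)⁻¹ else 0) else 0 := by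
      intro l _
      simp only [hW]
      split_ifs <;> simp
    rw [Finset.sum_congr rfl this, ← Finset.sum_filter, Finset.filter_mem_eq_inter,
      Finset.inter_eq_right.2 hPsub]
    exact Finset.sum_le_sum fun p hp => Nat.sum_multiples_inv_le (hP p hp).pos
  set A := Finset.univ.filter fun σ : Perm α => h ≤ |cycleCount P σ - h| with hA
  set B := Finset.univ.filter fun σ : Perm α => 1 ≤ Q σ with hB
  have hAcard : (A.card : ℝ) ≤ m.factorial * h⁻¹ := by
    have := card_cycleCount_deviation_le hPsub hpos.le
    rw [← hh] at this
    rw [← div_eq_mul_inv, le_div_iff₀ hpos]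
    refine le_of_mul_le_mul_right ?_ hpos
    calc (A.card : ℝ) * h * h = A.card * h ^ 2 := by ring
      _ ≤ _ := this
  have hBcard : (B.card : ℝ) ≤ ∑ σ, Q σ := by
    have h1 : (B.card : ℝ) = ∑ σ ∈ B, (1 : ℝ) := by simp
    rw [h1]
    exact (Finset.sum_le_sum fun σ hσ => (Finset.mem_filter.1 hσ).2).trans
      (Finset.sum_le_sum_of_subset_of_nonneg (Finset.filter_subset _ _) fun σ _ _ => hQ0 σ)
  have hsub : (Finset.univ.filter fun σ : Perm α => ¬ HasPrimeCyclePower a b σ) ⊆ A ∪ B := by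
    intro σ hσ
    have hσ := (Finset.mem_filter.1 hσ).2
    by_cases hx : ∃ x, minimalPeriod σ x ∈ P
    · obtain ⟨x, hx⟩ := hx
      refine Finset.mem_union_right _ (Finset.mem_filter.2 ⟨Finset.mem_univ _, ?_⟩)
      have hpr := hP _ hx
      obtain ⟨y, hy, hxy⟩ : ∃ y, ¬ σ.SameCycle x y ∧ minimalPeriod σ x ∣ minimalPeriod σ y := by
        by_contra hcon
        push Not at hcon
        refine hσ ⟨σ.cycleOf x, cycleOf_mem_zpowers fun y hy =>
          (Nat.Prime.coprime_iff_not_dvd hpr).2 (hcon y hy),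
          isCycle_cycleOf_of_one_lt hpr.one_lt, ?_⟩
        rw [card_support_cycleOf_eq hpr.one_lt]
        exact ⟨hpr, ha _ hx, hb _ hx⟩
      let C := (Finset.univ.filter fun z => σ.SameCycle x z) ×ˢ
        (Finset.univ.filter fun z => σ.SameCycle y z)
      have hC : ∑ z ∈ C, (if σ.SameCycle z.1 z.2 then 0 else
          W (minimalPeriod σ z.1) (minimalPeriod σ z.2)) = 1 := by
        have : ∀ z ∈ C, (if σ.SameCycle z.1 z.2 then 0 else
          W (minimalPeriod σ z.1) (minimalPeriod σ z.2)) =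
            (minimalPeriod σ x : ℝ)⁻¹ * (minimalPeriod σ y : ℝ)⁻¹ := by
          intro z hz
          simp only [C, Finset.mem_product, Finset.mem_filter, Finset.mem_univ, true_and] at hz
          rw [if_neg fun hzz => hy (hz.1.trans (hzz.trans hz.2.symm)),
            ← hz.1.minimalPeriod_eq, ← hz.2.minimalPeriod_eq]
          simp only [hW, hx, hxy, if_true]
        rw [Finset.sum_congr rfl this, Finset.sum_const, Finset.card_product, card_sameCycle,
          card_sameCycle, nsmul_eq_mul]
        have h1 : (minimalPeriod σ x : ℝ) ≠ 0 := by exact_mod_cast (minimalPeriod_pos σ x).ne'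
        have h2 : (minimalPeriod σ y : ℝ) ≠ 0 := by exact_mod_cast (minimalPeriod_pos σ y).ne'
        push_cast
        field_simp
      rw [← hC]
      exact Finset.sum_le_sum_of_subset_of_nonneg (Finset.subset_univ _) fun z _ _ => hterm0 σ z
    · push Not at hx
      refine Finset.mem_union_left _ (Finset.mem_filter.2 ⟨Finset.mem_univ _, ?_⟩)
      have : cycleCount P σ = 0 := Finset.sum_eq_zero fun x _ => by simp [hx x]
      rw [this, zero_sub, abs_neg, abs_of_pos hpos]
  rw [Nat.card_eq_fintype_card, Fintype.card_subtype]
  have hcard : ((Finset.univ.filter fun σ : Perm α => ¬ HasPrimeCyclePower a b σ).card : ℝ) ≤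
      A.card + B.card := by
    exact_mod_cast (Finset.card_le_card hsub).trans (Finset.card_union_le _ _)
  rw [mul_add]
  linarith

end Equiv.Perm

/-! ### Reciprocal sums of primes, and abundance of prime cycle powers. -/

theorem eventually_pow_le_theta_sub :
    ∀ᶠ j : ℕ in atTop, (8 : ℝ) ^ j ≤ Chebyshev.theta (8 ^ (j + 1)) - Chebyshev.theta (8 ^ j) := by
  have h1 : ∀ᶠ x : ℝ in atTop, Real.log x ≤ 1 / 8 * Real.sqrt x := by
    have := (isLittleO_log_rpow_atTop (r := 1 / 2) (by norm_num)).bound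
      (show (0 : ℝ) < 1 / 8 by norm_num)
    filter_upwards [this, eventually_ge_atTop 1] with x hx h1
    rw [Real.norm_of_nonneg (Real.log_nonneg h1),
      Real.norm_of_nonneg (by positivity), ← Real.sqrt_eq_rpow] at hx
    exact hx
  have h2 : Tendsto (fun j : ℕ => (8 : ℝ) ^ (j + 1)) atTop atTop :=
    (tendsto_pow_atTop_atTop_of_one_lt (by norm_num)).comp (tendsto_add_atTop_nat 1)
  filter_upwards [h2.eventually h1, h2.eventually (eventually_ge_atTop 4)] with j hj h4
  set y : ℝ := (8 : ℝ) ^ (j + 1) with hy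
  have hyx : (8 : ℝ) ^ j = y / 8 := by rw [hy, pow_succ]; ring
  have hlow : y * Real.log 2 - Real.log (y + 1) - 2 * √y * Real.log y ≤ Chebyshev.theta y := by
    have := Chebyshev.theta_ge (8 ^ (j + 1))
    push_cast at this
    exact this
  have hup := Chebyshev.theta_le_log4_mul_x (x := (8 : ℝ) ^ j) (by positivity)
  have hl4 : Real.log 4 = 2 * Real.log 2 := by
    rw [show (4 : ℝ) = 2 ^ 2 by norm_num, Real.log_pow]; norm_num
  have hsq : √y * √y = y := Real.mul_self_sqrt (by linarith)
  have hs2 : 2 ≤ √y := Real.le_sqrt_of_sq_le (by linarith)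
  have hlog1 : Real.log (y + 1) ≤ 2 * Real.log y := by
    have : 2 * Real.log y = Real.log (y ^ 2) := by exact_mod_cast (Real.log_pow y 2).symm
    rw [this]
    exact Real.log_le_log (by linarith) (by nlinarith)
  have hlog0 : 0 ≤ Real.log y := Real.log_nonneg (by linarith)
  -- The ratio `8` leaves a main term `(3 / 4) * log 2 * y ≥ 0.51 * y`. The errors total at most `3
  -- / 8 * y`, so more than `y / 8` survives.
  have e1 : √y * Real.log y ≤ 1 / 8 * y := by nlinarith
  have e2 : 2 * Real.log y ≤ √y * Real.log y := by nlinarith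
  have hlog2 := Real.log_two_gt_d9
  rw [hl4] at hup
  rw [hyx] at hup ⊢
  nlinarith

/-- The primes in the interval `(8 ^ a, 8 ^ b]`. -/
def primesBetweenPow (a b : ℕ) : Finset ℕ := (Finset.Ioc (8 ^ a) (8 ^ b)).filter Nat.Prime

/-- The block carries `theta`-mass at least `8 ^ j`, while each `p` in it has `p * log p ≤ 8 ^ (j +
1) * 3 * (j + 1)`; hence `24 = 8 * 3`. Summing over blocks replaces Mertens' theorem. -/
theorem eventually_le_sum_inv_primesBetweenPow_succ :
    ∀ᶠ j : ℕ in atTop, (1 / 24 : ℝ) * ((j + 1 : ℕ) : ℝ)⁻¹ ≤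
      ∑ p ∈ primesBetweenPow j (j + 1), (p : ℝ)⁻¹ := by
  filter_upwards [eventually_pow_le_theta_sub] with j hj
  have hθ : Chebyshev.theta (8 ^ (j + 1)) - Chebyshev.theta (8 ^ j) =
      ∑ p ∈ primesBetweenPow j (j + 1), Real.log p := by
    have h1 : ∀ k : ℕ, Chebyshev.theta (8 ^ k) =
        ∑ p ∈ (Finset.Ioc 0 (8 ^ k)).filter Nat.Prime, Real.log p := by
      intro k
      rw [Chebyshev.theta, show ((8 : ℝ) ^ k) = ((8 ^ k : ℕ) : ℝ) by push_cast; rfl,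
        Nat.floor_natCast]
    have hle : 8 ^ j ≤ 8 ^ (j + 1) := Nat.pow_le_pow_right (by norm_num) (by omega)
    have h2 : (Finset.Ioc 0 (8 ^ (j + 1))).filter Nat.Prime =
        (Finset.Ioc 0 (8 ^ j)).filter Nat.Prime ∪ primesBetweenPow j (j + 1) := by
      rw [primesBetweenPow, ← Finset.filter_union, Finset.Ioc_union_Ioc_eq_Ioc (by omega) hle]
    rw [h1, h1, h2, Finset.sum_union, add_sub_cancel_left]
    refine Finset.disjoint_filter_filter ?_
    rw [Finset.disjoint_left]
    intro p hp hp'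
    simp only [Finset.mem_Ioc] at hp hp'
    omega
  rw [hθ] at hj
  have hlog8 : Real.log 8 ≤ 3 := by
    rw [show (8 : ℝ) = 2 ^ 3 by norm_num, Real.log_pow]
    have := Real.log_two_lt_d9
    norm_num
    linarith
  have hb : ∀ p ∈ primesBetweenPow j (j + 1), Real.log p ≤
      (8 ^ j * (24 * (j + 1 : ℕ))) * (p : ℝ)⁻¹ := by
    intro p hp
    simp only [primesBetweenPow, Finset.mem_filter, Finset.mem_Ioc] at hp
    have hp0 : (0 : ℝ) < p := by exact_mod_cast hp.2.pos
    have hp8 : (p : ℝ) ≤ 8 ^ (j + 1) := by exact_mod_cast hp.1.2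
    have hl : Real.log p ≤ (j + 1 : ℕ) * 3 := by
      refine (Real.log_le_log hp0 hp8).trans ?_
      rw [Real.log_pow]
      gcongr
    rw [← div_eq_mul_inv, le_div_iff₀ hp0]
    calc Real.log p * p ≤ ((j + 1 : ℕ) * 3) * 8 ^ (j + 1) := by gcongr
      _ = _ := by rw [pow_succ]; ring
  have := hj.trans (Finset.sum_le_sum hb)
  rw [← Finset.mul_sum] at this
  have h8 : (0 : ℝ) < 8 ^ j := by positivity
  have hj1 : (0 : ℝ) < (j + 1 : ℕ) := by positivity
  set s := ∑ p ∈ primesBetweenPow j (j + 1), (p : ℝ)⁻¹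
  have h3 : 1 ≤ (24 * ((j + 1 : ℕ) : ℝ)) * s := by
    refine le_of_mul_le_mul_left ?_ h8
    rw [mul_one, ← mul_assoc]
    exact this
  rw [one_div, ← mul_inv, inv_le_iff_one_le_mul₀ (by positivity), mul_comm]
  exact h3

theorem exists_le_sum_inv_primesBetweenPow :
    ∃ a₀ : ℕ, ∀ a ≥ a₀, ∀ b ≥ a, (1 / 24 : ℝ) * ((harmonic b : ℝ) - (harmonic a : ℝ)) ≤
      ∑ p ∈ primesBetweenPow a b, (p : ℝ)⁻¹ := by
  obtain ⟨a₀, h₀⟩ := eventually_atTop.1 eventually_le_sum_inv_primesBetweenPow_succ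
  refine ⟨a₀, fun a ha b hab => ?_⟩
  induction b, hab using Nat.le_induction with
  | base => simp [primesBetweenPow]
  | succ b hab ih =>
    have h1 : 8 ^ a ≤ 8 ^ b := Nat.pow_le_pow_right (by norm_num) hab
    have h2 : 8 ^ b ≤ 8 ^ (b + 1) := Nat.pow_le_pow_right (by norm_num) (by omega)
    have hu : primesBetweenPow a (b + 1) = primesBetweenPow a b ∪ primesBetweenPow b (b + 1) := by
      simp only [primesBetweenPow]
      rw [← Finset.filter_union, Finset.Ioc_union_Ioc_eq_Ioc h1 h2]
    rw [hu, Finset.sum_union, harmonic_succ]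
    · have := h₀ b (by omega)
      push_cast at this ⊢
      linarith
    · refine Finset.disjoint_filter_filter ?_
      rw [Finset.disjoint_left]
      intro p hp hp'
      simp only [Finset.mem_Ioc] at hp hp'
      omega

theorem sum_inv_sq_primesBetweenPow_le (a b : ℕ) :
    ∑ p ∈ primesBetweenPow a b, ((p : ℝ) ^ 2)⁻¹ ≤ ((8 : ℝ) ^ a)⁻¹ := by
  rcases le_or_gt a b with hab | hab
  · have h1 : 8 ^ a ≤ 8 ^ b := Nat.pow_le_pow_right (by norm_num) hab
    refine (Finset.sum_le_sum_of_subset_of_nonneg (Finset.filter_subset _ _)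
      fun _ _ _ => by positivity).trans ?_
    refine (sum_Ioc_inv_sq_le_sub (α := ℝ) (by positivity) h1).trans ?_
    push_cast
    have : (0 : ℝ) ≤ (8 ^ b)⁻¹ := by positivity
    linarith
  · rw [primesBetweenPow, Finset.Ioc_eq_empty_of_le (Nat.pow_le_pow_right (by norm_num) hab.le)]
    simp only [Finset.filter_empty, Finset.sum_empty]
    positivity

theorem sum_Icc_inv_eq_harmonic (n : ℕ) :
    ∑ l ∈ Finset.Icc 1 n, (l : ℝ)⁻¹ = (harmonic n : ℝ) := by
  rw [harmonic_eq_sum_Icc]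
  push_cast
  rfl

/-- The reciprocals of the primes between `8 ^ a` and `8 ^ (a ^ 2)` have a large sum, and their
squares a negligible one. -/
theorem eventually_primesBetweenPow_sq {ε : ℝ} (hε : 0 < ε) :
    ∀ᶠ a : ℕ in atTop, 0 < ∑ p ∈ primesBetweenPow a (a ^ 2), (p : ℝ)⁻¹ ∧
      (∑ p ∈ primesBetweenPow a (a ^ 2), (p : ℝ)⁻¹)⁻¹ + (2 + 3 * ((a : ℝ) + 1) ^ 2) *
        ∑ p ∈ primesBetweenPow a (a ^ 2), ((p : ℝ) ^ 2)⁻¹ ≤ ε := by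
  obtain ⟨a₀, h₀⟩ := exists_le_sum_inv_primesBetweenPow
  have hlog : Tendsto (fun a : ℕ => Real.log a) atTop atTop :=
    Real.tendsto_log_atTop.comp tendsto_natCast_atTop_atTop
  have hpoly : Tendsto (fun a : ℕ => (2 + 3 * ((a : ℝ) + 1) ^ 2) * ((8 : ℝ) ^ a)⁻¹) atTop
      (𝓝 0) := by
    have h (k : ℕ) : Tendsto (fun a : ℕ => (a : ℝ) ^ k * ((8 : ℝ) ^ a)⁻¹) atTop (𝓝 0) := by
      simpa [div_eq_mul_inv] using
        tendsto_pow_const_div_const_pow_of_one_lt k (r := (8 : ℝ)) (by norm_num)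
    have := (((h 2).const_mul 3).add ((h 1).const_mul 6)).add ((h 0).const_mul 5)
    simp only [mul_zero, add_zero] at this
    refine this.congr fun a => ?_
    ring
  -- The harmonic difference between `a` and `a ^ 2` is at least `log a - 1`. Asking for `48 / ε`
  -- here makes the prime sum at least `2 / ε`.
  filter_upwards [eventually_ge_atTop a₀, eventually_ge_atTop 1,
    hlog.eventually (eventually_ge_atTop (1 + 48 / ε)),
    hpoly.eventually (eventually_le_nhds (half_pos hε))] with a ha ha1 hla hpa
  have h1 := h₀ a ha (a ^ 2) (by nlinarith)
  have h2 := log_add_one_le_harmonic (a ^ 2)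
  have h3 := harmonic_le_one_add_log a
  have ha0 : (0 : ℝ) < a := by exact_mod_cast ha1
  have h4 : 2 * Real.log a ≤ Real.log ((a ^ 2 : ℕ) + 1) := by
    have : 2 * Real.log a = Real.log ((a : ℝ) ^ 2) := by rw [Real.log_pow]; norm_num
    rw [this]
    refine Real.log_le_log (by positivity) ?_
    push_cast
    linarith
  set s := ∑ p ∈ primesBetweenPow a (a ^ 2), (p : ℝ)⁻¹
  have hs : 2 / ε ≤ s := by
    have : (48 : ℝ) / ε = 24 * (2 / ε) := by ring
    push_cast at h2 h4
    linarith
  have hs0 : 0 < s := lt_of_lt_of_le (by positivity) hs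
  refine ⟨hs0, ?_⟩
  have e1 : s⁻¹ ≤ ε / 2 := by
    rw [inv_le_comm₀ hs0 (by positivity)]
    simpa using hs
  have e2 := mul_le_mul_of_nonneg_left (sum_inv_sq_primesBetweenPow_le a (a ^ 2))
    (show (0 : ℝ) ≤ 2 + 3 * ((a : ℝ) + 1) ^ 2 by positivity)
  linarith

/-- Almost every permutation of a large finite set has a power that is a cycle of large prime
length, moving at most half of the points. -/
theorem eventually_card_not_hasPrimeCyclePower_le {ε : ℝ} (hε : 0 < ε) (Y : ℕ) :
    ∀ᶠ n : ℕ in atTop, (Nat.card {σ : Equiv.Perm (Fin n) //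
      ¬ Equiv.Perm.HasPrimeCyclePower Y (n / 2) σ} : ℝ) ≤ ε * n.factorial := by
  have hlog : Tendsto (fun n : ℕ => Nat.log 8 (n / 2)) atTop atTop := by
    refine tendsto_atTop.2 fun b => ?_
    filter_upwards [eventually_ge_atTop (2 * 8 ^ b)] with n hn
    exact Nat.le_log_of_pow_le (by norm_num) (by omega)
  have hsqrt : Tendsto Nat.sqrt atTop atTop := by
    refine tendsto_atTop.2 fun b => ?_
    filter_upwards [eventually_ge_atTop (b * b)] with n hn
    exact Nat.le_sqrt.2 hn
  filter_upwards [(hsqrt.comp hlog).eventually (eventually_primesBetweenPow_sq hε),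
    (hsqrt.comp hlog).eventually (eventually_ge_atTop Y), eventually_ge_atTop 2]
    with n hn hY hn2
  simp only [Function.comp_apply] at hn hY
  set J := Nat.log 8 (n / 2) with hJ
  -- This choice gives `8 ^ (a ^ 2) ≤ n / 2`, so the primes used are at most `n / 2`, and `n ≤ 2 * 8
  -- ^ ((a + 1) ^ 2)`, so the harmonic factor is only polynomial in `a`.
  set a := Nat.sqrt J with ha
  obtain ⟨hpos, hle⟩ := hn
  have haJ : a ^ 2 ≤ J := Nat.sqrt_le' J
  have hJa : J + 1 ≤ (a + 1) ^ 2 := by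
    have := Nat.lt_succ_sqrt' J
    simpa using this
  have hpow : 8 ^ (a ^ 2) ≤ n / 2 :=
    (Nat.pow_le_pow_right (by norm_num) haJ).trans (Nat.pow_log_le_self 8 (by omega))
  have hn8 : n ≤ 2 * 8 ^ ((a + 1) ^ 2) := by
    have h1 : n / 2 < 8 ^ (J + 1) := Nat.lt_pow_succ_log_self (by norm_num) _
    have h2 : 8 ^ (J + 1) ≤ 8 ^ ((a + 1) ^ 2) := Nat.pow_le_pow_right (by norm_num) hJa
    omega
  have hH : ∑ j ∈ Finset.Icc 1 n, (j : ℝ)⁻¹ ≤ 2 + 3 * ((a : ℝ) + 1) ^ 2 := by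
    rw [sum_Icc_inv_eq_harmonic]
    have h1 := harmonic_le_one_add_log n
    have h2 : Real.log n ≤ Real.log (2 * 8 ^ ((a + 1) ^ 2)) :=
      Real.log_le_log (by exact_mod_cast (by omega : 0 < n)) (by exact_mod_cast hn8)
    rw [Real.log_mul (by norm_num) (by positivity), Real.log_pow,
      show (8 : ℝ) = 2 ^ 3 by norm_num, Real.log_pow] at h2
    have h3 := Real.log_two_lt_d9
    have h4 : (0 : ℝ) ≤ ((a : ℝ) + 1) ^ 2 := by positivity
    push_cast at h2
    nlinarith
  have hsub : ∀ p ∈ primesBetweenPow a (a ^ 2), (8 ^ a < p ∧ p ≤ 8 ^ (a ^ 2)) ∧ p.Prime := by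
    intro p hp
    simpa [primesBetweenPow] using hp
  have hYa : Y ≤ 8 ^ a := hY.trans (Nat.lt_pow_self (by norm_num)).le
  have key := Equiv.Perm.card_not_hasPrimeCyclePower_le (α := Fin n) (a := Y) (b := n / 2)
    (P := primesBetweenPow a (a ^ 2)) (fun p hp => (hsub p hp).2)
    (fun p hp => hYa.trans (hsub p hp).1.1.le) (fun p hp => (hsub p hp).1.2.trans hpow)
    (by simp; omega) hpos
  rw [Fintype.card_fin] at key
  refine key.trans ?_
  rw [mul_comm]
  refine mul_le_mul_of_nonneg_right (le_trans ?_ hle) (by positivity)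
  gcongr

/-! ### Prime cycles in primitive and imprimitive groups. -/

namespace Equiv.Perm

open MulAction

variable {α : Type*} [Fintype α] [DecidableEq α]

/-- The commutator of two permutations whose supports meet in exactly one point is a three-cycle. -/
theorem isThreeCycle_commutator {c d : Perm α} {x : α} (hcx : c x ≠ x) (hdx : d x ≠ x)
    (h : ∀ t, t ≠ x → c t = t ∨ d t = t) : (c * d * c⁻¹ * d⁻¹).IsThreeCycle := by
  have hdc : d (c x) = c x :=
    (h (c x) hcx).resolve_left fun hc => hcx (c.injective hc)
  have hcd : c (d x) = d x :=
    (h (d x) hdx).resolve_right fun hd => hdx (d.injective hd)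
  have hne : d x ≠ c x := fun he => hdx (d.injective (by rw [he, hdc]))
  have heq : c * d * c⁻¹ * d⁻¹ = swap (d x) (c x) * swap (d x) x := by
    rw [mul_inv_eq_iff_eq_mul, mul_inv_eq_iff_eq_mul]
    ext t
    simp only [Perm.mul_apply]
    have hfix : ∀ v, v ≠ d x → v ≠ x → v ≠ c x →
        swap (d x) (c x) (swap (d x) x v) = v := fun v h1 h2 h3 => by
      rw [swap_apply_of_ne_of_ne h1 h2, swap_apply_of_ne_of_ne h1 h3]
    have hcfix : ∀ v, c v = v → v ≠ x ∧ v ≠ c x := fun v hv =>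
      ⟨fun he => hcx (he ▸ hv), fun he => hcx (c.injective (he ▸ hv))⟩
    have hdfix : ∀ v, d v = v → v ≠ d x := fun v hv he => hdx (d.injective (he ▸ hv))
    by_cases htx : t = x
    · subst htx
      rw [hdc, swap_apply_of_ne_of_ne hne.symm hcx, swap_apply_right, hcd]
    have hdtx : d t ≠ d x := fun he => htx (d.injective he)
    rcases h t htx with ht | ht
    · rw [ht]
      by_cases hdt : c (d t) = d t
      · rw [hdt, hfix _ hdtx (hcfix _ hdt).1 (hcfix _ hdt).2]
      · have hdtx' : d t = x := by
          by_contra hdx'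
          have h2 := d.injective ((h _ hdx').resolve_left hdt)
          rw [h2] at hdt
          exact hdt ht
        rw [hdtx', swap_apply_right, swap_apply_left]
    · rw [ht]
      by_cases hctx : c t = x
      · rw [hctx, swap_apply_left, swap_apply_of_ne_of_ne hdx.symm hcx.symm]
      · have hdct : d (c t) = c t := by
          rcases h _ hctx with hcc | hdd
          · rw [c.injective hcc, ht]
          · exact hdd
        rw [hdct, hfix _ (hdfix _ hdct) hctx fun he => htx (c.injective he)]
  rw [heq]
  exact isThreeCycle_swap_mul_swap_same hne hdx hcx

/-- A primitive group containing a cycle of prime length that moves at most half of the points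
contains the alternating group. -/
theorem alternatingGroup_le_of_isPreprimitive_of_prime_cycle {K : Subgroup (Perm α)}
    (hK : IsPreprimitive K α) {c : Perm α} (hc : c.IsCycle) (hcK : c ∈ K)
    (hp : c.support.card.Prime) (hp2 : 2 * c.support.card ≤ Fintype.card α) :
    alternatingGroup α ≤ K := by
  set p := c.support.card with hpdef
  have hp1 := hp.two_le
  have hcard : Nat.card α = Fintype.card α := Nat.card_eq_fintype_card
  -- Jordan's theorem: the pointwise stabilizer of the `n - p` fixed points of `c` is primitive on
  -- the remaining `p`, so `K` is `(n - p + 1)`-transitive, hence `p`-transitive because `2 * p ≤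
  -- n`.
  have hmult : IsMultiplyPretransitive K α (Fintype.card α - p - 1 + 2) := by
    suffices IsMultiplyPreprimitive K α (Fintype.card α - p - 1 + 2) from
      IsMultiplyPreprimitive.isMultiplyPretransitive ..
    apply hK.isMultiplyPreprimitive (s := (c.supportᶜ : Set α))
    · apply Nat.add_left_cancel
      rw [Set.ncard_add_ncard_compl, Set.ncard_coe_finset, hcard]
      omega
    · omega
    have := isPretransitive_of_isCycle_mem hc hcK
    apply IsPreprimitive.of_prime_card
    convert! hp
    classical
    rw [Nat.card_eq_fintype_card, Fintype.card_subtype, hpdef]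
    apply congr_arg
    ext x
    simp [SubMulAction.mem_ofFixingSubgroup_iff]
  have hmultp : IsMultiplyPretransitive K α p :=
    isMultiplyPretransitive_of_le (n := Fintype.card α - p - 1 + 2) (by omega) (by omega)
  obtain ⟨x, hx⟩ : c.support.Nonempty := by
    rw [← Finset.card_pos]
    omega
  let e : Fin p ≃ c.support := (Finset.equivFinOfCardEq hpdef.symm).symm
  have hcompl : Fintype.card (Fin p) ≤ Fintype.card {t // t ∉ c.support} := by
    rw [Fintype.card_subtype_compl, Fintype.card_coe, Fintype.card_fin]
    omega
  obtain ⟨f⟩ := Function.Embedding.nonempty_of_card_le hcompl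
  let e₁ : Fin p ↪ α := e.toEmbedding.trans (Function.Embedding.subtype _)
  -- A `g ∈ K` taking `e₁` to `e₂` fixes `x` and moves the rest of the support of `c` off it. The
  -- supports of `c` and its conjugate by `g` then meet only in `x`.
  let e₂ : Fin p ↪ α := ⟨fun i => if e₁ i = x then x else f i, by
    intro i j hij
    dsimp only at hij
    split_ifs at hij with h1 h2 h2
    · exact e₁.injective (h1.trans h2.symm)
    · exact absurd (hij ▸ hx) (f j).2
    · exact absurd (hij ▸ hx) (f i).2
    · exact f.injective (Subtype.ext hij)⟩
  obtain ⟨g, hg⟩ := hmultp.exists_smul_eq e₁ e₂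
  have hg' : ∀ i, (g : Perm α) (e₁ i) = if e₁ i = x then x else f i := fun i =>
    DFunLike.congr_fun hg i
  have he₁ : ∀ t ∈ c.support, ∃ i, e₁ i = t := fun t ht => ⟨e.symm ⟨t, ht⟩, by simp [e₁]⟩
  have hgx : (g : Perm α) x = x := by
    obtain ⟨i, hi⟩ := he₁ x hx
    have := hg' i
    rwa [if_pos hi, hi] at this
  have hgout : ∀ t ∈ c.support, t ≠ x → (g : Perm α) t ∉ c.support := by
    intro t ht htx
    obtain ⟨i, hi⟩ := he₁ t ht
    have := hg' i
    rw [if_neg (hi ▸ htx), hi] at this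
    rw [this]
    exact (f i).2
  let d : Perm α := g * c * g⁻¹
  have hd : ∀ t, d t = (g : Perm α) (c ((g : Perm α)⁻¹ t)) := fun t => rfl
  have hginv : (g : Perm α)⁻¹ x = x := by
    rw [Perm.inv_eq_iff_eq, hgx]
  have h3 : (c * d * c⁻¹ * d⁻¹).IsThreeCycle := by
    refine isThreeCycle_commutator (x := x) (mem_support.1 hx) ?_ ?_
    · rw [hd, hginv]
      intro he
      exact mem_support.1 hx ((g : Perm α).injective (he.trans hgx.symm))
    · intro t htx
      by_contra hcon
      push Not at hcon
      have hs : (g : Perm α)⁻¹ t ∈ c.support := by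
        rw [mem_support]
        intro he
        apply hcon.2
        rw [hd, he]
        exact (g : Perm α).apply_symm_apply t
      have := hgout _ hs (by
        intro he
        apply htx
        rw [Perm.inv_eq_iff_eq, hgx] at he
        exact he)
      apply this
      rw [show (g : Perm α) ((g : Perm α)⁻¹ t) = t from (g : Perm α).apply_symm_apply t]
      exact mem_support.2 hcon.1
  have hdK : d ∈ K := K.mul_mem (K.mul_mem g.2 hcK) (K.inv_mem g.2)
  exact alternatingGroup_le_of_isPreprimitive_of_isThreeCycle_mem hK h3
    (K.mul_mem (K.mul_mem (K.mul_mem hcK hdK) (K.inv_mem hcK)) (K.inv_mem hdK))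

open scoped Pointwise in
/-- In a transitive group, an element with a power that is a cycle of prime length preserves some
translate of any nontrivial block, and the block is at least as long as the cycle. -/
theorem HasPrimeCyclePower.exists_invariant_of_isBlock {K : Subgroup (Perm α)}
    [IsPretransitive K α] {B : Set α} (hB : IsBlock K B) (hBn : B.Nontrivial) {a b : ℕ}
    {w : Perm α} (hw : w ∈ K) (h : HasPrimeCyclePower a b w) :
    a ≤ B.ncard ∧ ∃ S : Finset α, S.card = B.ncard ∧ ∀ x, w x ∈ S ↔ x ∈ S := by
  classical
  obtain ⟨c, hcw, hc, hp, ha, -⟩ := h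
  have hcK : c ∈ K := (Subgroup.zpowers_le.2 hw) hcw
  obtain ⟨t, ht⟩ : c.support.Nonempty := by
    rw [← Finset.card_pos]
    exact hp.pos
  obtain ⟨s, hs⟩ := hBn.nonempty
  obtain ⟨k, hk⟩ := exists_smul_eq K s t
  set B' := k • B with hB'
  have hblock : IsBlock K B' := hB.translate k
  have hncard : B'.ncard = B.ncard := Set.ncard_smul_set k B
  have htB : t ∈ B' := ⟨s, hs, hk⟩
  have hBn' : B'.Nontrivial := by
    rw [← Set.one_lt_ncard_iff_nontrivial, hncard, Set.one_lt_ncard_iff_nontrivial]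
    exact hBn
  obtain ⟨u, hu, hut⟩ := hBn'.exists_ne t
  -- If `c` moves the second point `u` of the block, then `u = c ^ j t` and `c ^ j` stabilizes `B'`.
  -- Since `c` has prime order and `u ≠ t`, it is a power of `c ^ j`.
  have hstab : (⟨c, hcK⟩ : K) • B' = B' := by
    by_cases hcu : c u = u
    · exact hblock.smul_eq_of_mem hu (by
        change c u ∈ B'
        rwa [hcu])
    · obtain ⟨j, hj⟩ := hc.exists_pow_eq (mem_support.1 ht) hcu
      have hj' : ((⟨c, hcK⟩ : K) ^ j) • B' = B' := hblock.smul_eq_of_mem htB (by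
        change (c ^ j) t ∈ B'
        rwa [hj])
      have hco : j.Coprime (orderOf (⟨c, hcK⟩ : K)) := by
        rw [Subgroup.orderOf_mk, hc.orderOf, Nat.coprime_comm, Nat.Prime.coprime_iff_not_dvd hp,
          ← hc.orderOf]
        intro hdvd
        rw [orderOf_dvd_iff_pow_eq_one.1 hdvd] at hj
        exact hut hj.symm
      obtain ⟨i, hi⟩ := exists_pow_eq_self_of_coprime hco
      have hmem : ((⟨c, hcK⟩ : K) ^ j) ^ i ∈ stabilizer K B' :=
        Subgroup.pow_mem _ (mem_stabilizer_iff.2 hj') i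
      rw [hi] at hmem
      exact hmem
  have hsub : (c.support : Set α) ⊆ B' := by
    intro v hv
    obtain ⟨i, hi⟩ := hc.exists_pow_eq (mem_support.1 ht) (mem_support.1 hv)
    have hmem : (⟨c, hcK⟩ : K) ^ i ∈ stabilizer K B' :=
      Subgroup.pow_mem _ (mem_stabilizer_iff.2 hstab) i
    rw [← mem_stabilizer_iff.1 hmem, ← hi]
    exact ⟨t, htB, rfl⟩
  -- `w` commutes with its power `c`, so it preserves the support of `c`, which lies in `B'`.
  have hwstab : (⟨w, hw⟩ : K) • B' = B' := by
    refine hblock.smul_eq_of_mem htB (hsub ?_)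
    change w t ∈ c.support
    obtain ⟨i, rfl⟩ := hcw
    rw [mem_support] at ht ⊢
    have : (w ^ i) (w t) = w ((w ^ i) t) := by
      rw [← Perm.mul_apply, ← Perm.mul_apply, (Commute.zpow_self w i).eq]
    intro he
    exact ht (w.injective (this.symm.trans he))
  refine ⟨ha.trans ?_, B'.toFinset, ?_, ?_⟩
  · rw [← hncard, ← Set.ncard_coe_finset]
    exact Set.ncard_le_ncard hsub
  · rw [← hncard, Set.ncard_eq_toFinset_card']
  · intro x
    rw [Set.mem_toFinset, Set.mem_toFinset]
    conv_lhs => rw [← hwstab]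
    exact Set.smul_mem_smul_set_iff (a := (⟨w, hw⟩ : K))

end Equiv.Perm

/-! ### Point stabilizers: intransitive, imprimitive or primitive. -/

section Structure

open MulAction Equiv
open scoped Pointwise

variable {n : ℕ} {G : Subgroup (Perm (Fin n))} {Ω : Type*} [MulAction G Ω]

theorem IsKSetAction.compl {k l : ℕ} (h : IsKSetAction G Ω k) (hkl : l + k = n) :
    IsKSetAction G Ω l := by
  obtain ⟨e, he⟩ := h
  have hkl' : l + k = Fintype.card (Fin n) := by simpa using hkl
  exact ⟨(Set.powersetCard.mulActionHom_compl G (Fin n) hkl').comp e,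
    (Set.powersetCard.mulActionHom_compl_bijective G (Fin n) hkl').comp he⟩

/-- An action of a group of permutations containing the alternating group whose point stabilizer
is the stabilizer of a set of `k` points is the action on the sets of `k` points. -/
theorem isKSetAction_of_stabilizer_eq (hn : 3 ≤ n) (hG : alternatingGroup (Fin n) ≤ G)
    [IsPretransitive G Ω] {k : ℕ} (x : Ω) (D : Set.powersetCard (Fin n) k)
    (h : stabilizer G D = stabilizer G x) : IsKSetAction G Ω k := by
  choose γ hγ using fun y : Ω => exists_smul_eq G x y
  have hiff : ∀ g g' : G, g • D = g' • D ↔ g • x = g' • x := by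
    intro g g'
    rw [← inv_smul_eq_iff, ← mul_smul, ← mem_stabilizer_iff, h, mem_stabilizer_iff, mul_smul,
      inv_smul_eq_iff]
  refine ⟨⟨fun y => γ y • D, fun g y => ?_⟩, ?_, ?_⟩
  · change γ (g • y) • D = g • γ y • D
    rw [← mul_smul, hiff, hγ, mul_smul, hγ]
  · intro y y' hy
    have := (hiff _ _).1 hy
    rwa [hγ, hγ] at this
  · intro E
    have := Set.powersetCard.isPretransitive_alternatingGroup (α := Fin n) (n := k) (by simpa)
    obtain ⟨g, hg⟩ := exists_smul_eq (alternatingGroup (Fin n)) D E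
    let g' : G := ⟨g, hG g.2⟩
    refine ⟨g' • x, ?_⟩
    have h1 : γ (g' • x) • D = g' • D := by rw [hiff, hγ]
    have h2 : g' • D = E := hg
    exact h1.trans h2

/-- The point stabilizer preserves one of its own orbits on `Fin n`, a nonempty proper subset whose
stabilizer in `G` is proper. Primitivity makes the point stabilizer maximal, so the two stabilizers
coincide. -/
theorem isKSetAction_of_not_isPretransitive (hn : 3 ≤ n) (hG : alternatingGroup (Fin n) ≤ G)
    [IsPreprimitive G Ω] [Nontrivial Ω] (x : Ω)
    (h : ¬ IsPretransitive ((stabilizer G x).map G.subtype) (Fin n)) :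
    ∃ k, k ≤ n ∧ IsKSetAction G Ω k := by
  classical
  set K := (stabilizer G x).map G.subtype with hK
  obtain ⟨a, b, hab⟩ : ∃ a b : Fin n, ∀ g : K, g • a ≠ b := by
    by_contra hcon
    push Not at hcon
    exact h ⟨hcon⟩
  let Δ : Finset (Fin n) := (orbit K a).toFinset
  let D : Set.powersetCard (Fin n) Δ.card := ⟨Δ, rfl⟩
  have haΔ : a ∈ Δ := by simp [Δ]
  have hbΔ : b ∉ Δ := by
    simp only [Δ, Set.mem_toFinset]
    rintro ⟨g, hg⟩
    exact hab g hg
  have hle : stabilizer G x ≤ stabilizer G D := by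
    intro g hg
    rw [mem_stabilizer_iff]
    apply Subtype.ext
    change g • Δ = Δ
    refine Finset.eq_of_subset_of_card_le ?_ (by simp)
    intro y hy
    obtain ⟨z, hz, rfl⟩ := Finset.mem_smul_finset.1 hy
    simp only [Δ, Set.mem_toFinset] at hz ⊢
    obtain ⟨k, rfl⟩ := hz
    have hgK : (g : Perm (Fin n)) ∈ K := ⟨g, hg, rfl⟩
    exact ⟨⟨g, hgK⟩ * k, mul_smul (⟨g, hgK⟩ : K) k a⟩
  have hne : stabilizer G D ≠ ⊤ := by
    intro htop
    have := alternatingGroup.isPretransitive_of_three_le_card (Fin n) (by simpa)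
    obtain ⟨g, hg⟩ := exists_smul_eq (alternatingGroup (Fin n)) a b
    let g' : G := ⟨g, hG g.2⟩
    have hmem : g' ∈ stabilizer G D := htop ▸ Subgroup.mem_top _
    have hD : g' • Δ = Δ := congrArg Subtype.val (mem_stabilizer_iff.1 hmem)
    apply hbΔ
    rw [← hD, ← hg]
    exact Finset.smul_mem_smul_finset (a := g') haΔ
  have hco : IsCoatom (stabilizer G x) := (isCoatom_stabilizer_iff_preprimitive G x).2 inferInstance
  have heq := ((hco.le_iff).1 hle).resolve_left hne
  refine ⟨Δ.card, ?_, isKSetAction_of_stabilizer_eq hn hG x D heq⟩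
  simpa using Finset.card_le_univ Δ

theorem two_mul_card_ge (hn : 2 ≤ n) (hG : alternatingGroup (Fin n) ≤ G) :
    n.factorial ≤ 2 * Nat.card G := by
  have : Nontrivial (Fin n) := Fin.nontrivial_iff_two_le.2 hn
  have h1 := two_mul_card_alternatingGroup (α := Fin n)
  rw [Fintype.card_perm, Fintype.card_fin, ← Nat.card_eq_fintype_card] at h1
  rw [← h1]
  exact Nat.mul_le_mul_left 2 (Subgroup.card_le_of_le hG)

/-- The stabilizer has index `|Ω| ≥ 3` in `G`, whereas a subgroup containing the alternating group
has index at most `2`. -/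
theorem not_alternatingGroup_le_map_stabilizer (hn : 2 ≤ n) [IsPretransitive G Ω]
    (hcard : 3 ≤ Nat.card Ω) (x : Ω) :
    ¬ alternatingGroup (Fin n) ≤ (stabilizer G x).map G.subtype := by
  intro hle
  have h1 := two_mul_card_ge hn hle
  have h2 : Nat.card ((stabilizer G x).map G.subtype) = Nat.card (stabilizer G x) :=
    Subgroup.card_map_of_injective G.subtype_injective
  have h3 := (stabilizer G x).card_mul_index
  rw [index_stabilizer_of_transitive] at h3
  have h4 : Nat.card G ≤ n.factorial := by
    have := Subgroup.card_le_card_group G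
    rwa [Nat.card_perm, Nat.card_fin] at this
  have h5 : 0 < Nat.card (stabilizer G x) := Nat.card_pos
  nlinarith

/-- A primitive action of the symmetric or alternating group of degree `n` is either the action on
`k`-sets, or elements with a fixed point and with a power that is a cycle of large prime length
preserve a large set of a fixed cardinality at most `n / 2`. -/
theorem isKSetAction_or_exists_invariant (hn : 3 ≤ n) (hG : alternatingGroup (Fin n) ≤ G)
    (hprim : IsPreprimitive G Ω) (hcard : 3 ≤ Nat.card Ω) :
    (∃ k, k ≤ n ∧ IsKSetAction G Ω k) ∨
    ∃ a, 2 * a ≤ n ∧ ∀ w : G, (∃ x : Ω, w • x = x) → ∀ Y,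
      Perm.HasPrimeCyclePower Y (n / 2) (w : Perm (Fin n)) →
      Y ≤ a ∧ ∃ S : Finset (Fin n), S.card = a ∧ ∀ x, (w : Perm (Fin n)) x ∈ S ↔ x ∈ S := by
  have : Finite Ω := Nat.finite_of_card_ne_zero (by omega)
  have : Nontrivial Ω := (Finite.one_lt_card_iff_nontrivial).1 (by omega)
  obtain ⟨x⟩ : Nonempty Ω := inferInstance
  by_cases htrans : IsPretransitive ((stabilizer G x).map G.subtype) (Fin n)
  swap
  · exact Or.inl (isKSetAction_of_not_isPretransitive hn hG x htrans)
  right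
  set K := (stabilizer G x).map G.subtype with hK
  have hconj : ∀ w : G, (∃ x : Ω, w • x = x) → ∃ g : Perm (Fin n),
      g * w * g⁻¹ ∈ K := by
    rintro w ⟨y, hy⟩
    obtain ⟨g, rfl⟩ := exists_smul_eq G y x
    refine ⟨g, ⟨g * w * g⁻¹, ?_, by simp⟩⟩
    simp [mul_smul, hy]
  by_cases hp : IsPreprimitive K (Fin n)
  · have hnot := not_alternatingGroup_le_map_stabilizer (G := G) (by omega) hcard x
    -- No element satisfies the hypotheses in this case, so the value `0` is arbitrary.
    refine ⟨0, by simp, fun w hw Y hY => absurd ?_ hnot⟩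
    obtain ⟨g, hg⟩ := hconj w hw
    obtain ⟨c, hc, hcyc, hpr, -, hle⟩ := hY.conj g
    exact Perm.alternatingGroup_le_of_isPreprimitive_of_prime_cycle hp hcyc
      ((Subgroup.zpowers_le.2 hg) hc) hpr (by rw [Fintype.card_fin]; omega)
  · obtain ⟨B, hB, hBt⟩ : ∃ B : Set (Fin n), IsBlock K B ∧ ¬ IsTrivialBlock B := by
      by_contra hcon
      push Not at hcon
      exact hp ⟨fun {B} hB => hcon B hB⟩
    simp only [IsTrivialBlock, not_or, Set.not_subsingleton_iff] at hBt
    refine ⟨B.ncard, ?_, fun w hw Y hY => ?_⟩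
    · obtain ⟨m, hm⟩ := hB.ncard_dvd_card hBt.1.nonempty
      rw [Nat.card_fin] at hm
      have hlt : B.ncard < n := by
        have := Set.ncard_lt_card hBt.2
        rwa [Nat.card_fin] at this
      have : 2 ≤ m := by
        by_contra hm2
        interval_cases m <;> omega
      nlinarith
    · obtain ⟨g, hg⟩ := hconj w hw
      obtain ⟨h1, S, hS, hinv⟩ := (hY.conj g).exists_invariant_of_isBlock hB hBt.1 hg
      refine ⟨h1, S.map (g⁻¹ : Perm (Fin n)).toEmbedding, by simpa using hS, fun z => ?_⟩
      have hmem : ∀ z, z ∈ S.map (g⁻¹ : Perm (Fin n)).toEmbedding ↔ g z ∈ S := fun z => by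
        rw [Finset.mem_map_equiv]
        rfl
      have := hinv (g z)
      simp only [Perm.mul_apply] at this
      rw [show g⁻¹ (g z) = z from g.symm_apply_apply z] at this
      rw [hmem, hmem, this]

end Structure

/-! ### Bounded `k`-set actions or almost all derangements. -/

section Dichotomy

open MulAction Equiv
open scoped Pointwise

theorem one_sub_derangementProportion (G Ω : Type*) [Group G] [Finite G] [MulAction G Ω] :
    1 - derangementProportion G Ω = (Nat.card {w : G // ∃ x : Ω, w • x = x} : ℝ) / Nat.card G := by
  classical
  have := Fintype.ofFinite G
  have h : Nat.card {w : G // ∃ x : Ω, w • x = x} + Nat.card {w : G // ∀ x : Ω, w • x ≠ x} =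
      Nat.card G := by
    simp only [Nat.card_eq_fintype_card]
    rw [Fintype.card_congr (Equiv.subtypeEquivRight (p := fun w : G => ∀ x : Ω, w • x ≠ x)
      (q := fun w : G => ¬ ∃ x : Ω, w • x = x)
      fun w => by simp), Fintype.card_subtype_compl]
    have := Fintype.card_subtype_le (fun w : G => ∃ x : Ω, w • x = x)
    omega
  have h0 : (Nat.card G : ℝ) ≠ 0 := by exact_mod_cast Nat.card_pos.ne'
  rw [derangementProportion, eq_div_iff h0, sub_mul, div_mul_cancel₀ _ h0, ← h]
  push_cast
  ring

/-- A primitive action of a symmetric or alternating group of large degree is either the action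
on `k`-sets with `k` bounded, or almost all group elements are derangements. -/
theorem exists_isKSetAction_or_derangementProportion_ge {ε : ℝ} (hε : 0 < ε) :
    ∃ k₀ n₀ : ℕ, ∀ n ≥ n₀, ∀ (G : Subgroup (Perm (Fin n))) (Ω : Type*) [MulAction G Ω],
      alternatingGroup (Fin n) ≤ G → IsPreprimitive G Ω → 3 ≤ Nat.card Ω →
      (∃ k ≤ k₀, IsKSetAction G Ω k) ∨ 1 - derangementProportion G Ω ≤ ε := by
  classical
  have hharm : Tendsto (fun k : ℕ => Real.log ((k + 1 : ℕ) : ℝ)) atTop atTop :=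
    Real.tendsto_log_atTop.comp (tendsto_natCast_atTop_atTop.comp (tendsto_add_atTop_nat 1))
  -- Dividing `36` by `144 / ε` gives `ε / 4`. Two exceptional sets of that density in the symmetric
  -- group cost at most `ε` in `G`, whose index is at most `2`.
  obtain ⟨k₀, hk₀, hk₁⟩ := ((hharm.eventually (eventually_ge_atTop (144 / ε))).and
    (eventually_ge_atTop 1)).exists
  have hinvariant : ∀ n k, k₀ ≤ k → 2 * k ≤ n →
      ((Finset.univ.filter fun σ : Perm (Fin n) =>
        ∃ S : Finset (Fin n), S.card = k ∧ ∀ x, σ x ∈ S ↔ x ∈ S).card : ℝ) ≤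
        ε / 4 * n.factorial := by
    intro n k hk hkn
    have h1 := Perm.card_exists_invariant_le (α := Fin n) (k := k) (by omega) (by simpa)
    have h2 : 144 / ε ≤ ∑ l ∈ Finset.Icc 1 k, (l : ℝ)⁻¹ := by
      rw [sum_Icc_inv_eq_harmonic]
      refine hk₀.trans (le_trans ?_ (log_add_one_le_harmonic k))
      refine Real.log_le_log (by positivity) ?_
      push_cast
      gcongr
    rw [Fintype.card_fin] at h1
    rw [← Fintype.card_subtype, ← Nat.card_eq_fintype_card]
    have h4 := (mul_le_mul_of_nonneg_left h2 (Nat.cast_nonneg _)).trans h1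
    rw [mul_div_assoc', div_le_iff₀ hε] at h4
    linarith
  obtain ⟨n₀, hn₀⟩ := eventually_atTop.1
    (eventually_card_not_hasPrimeCyclePower_le (show 0 < ε / 4 by positivity) k₀)
  refine ⟨k₀, max n₀ 3, fun n hn G Ω _ hG hprim hcard => ?_⟩
  have hn3 : 3 ≤ n := (le_max_right _ _).trans hn
  have hgood := hn₀ n ((le_max_left _ _).trans hn)
  rw [Nat.card_eq_fintype_card, Fintype.card_subtype] at hgood
  have hconcl : ∀ T : Finset (Perm (Fin n)), (T.card : ℝ) ≤ ε / 2 * n.factorial →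
      (∀ w : G, (∃ x : Ω, w • x = x) → (w : Perm (Fin n)) ∈ T) →
      1 - derangementProportion G Ω ≤ ε := by
    intro T hT hw
    rw [one_sub_derangementProportion, div_le_iff₀ (by exact_mod_cast Nat.card_pos)]
    have h1 : Nat.card {w : G // ∃ x : Ω, w • x = x} ≤ T.card := by
      have := Nat.card_le_card_of_injective
        (fun w : {w : G // ∃ x : Ω, w • x = x} => (⟨w.1, hw w.1 w.2⟩ : T)) (by
          intro w w' h
          have h' := congrArg (fun t : T => (t : Perm (Fin n))) h
          exact Subtype.ext (Subtype.ext h'))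
      simpa using this
    have h2 : (n.factorial : ℝ) ≤ 2 * Nat.card G := by
      exact_mod_cast two_mul_card_ge (by omega) hG
    calc (Nat.card {w : G // ∃ x : Ω, w • x = x} : ℝ) ≤ T.card := by exact_mod_cast h1
      _ ≤ ε / 2 * n.factorial := hT
      _ ≤ ε / 2 * (2 * Nat.card G) := by gcongr
      _ = ε * Nat.card G := by ring
  have hmono : ε / 4 * n.factorial ≤ ε / 2 * n.factorial := by gcongr; norm_num
  rcases isKSetAction_or_exists_invariant hn3 hG hprim hcard with ⟨k, hkn, hk⟩ | ⟨a, ha, hw⟩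
  · obtain ⟨k', hk', hkn'⟩ : ∃ k', IsKSetAction G Ω k' ∧ 2 * k' ≤ n := by
      rcases le_or_gt (2 * k) n with h | h
      · exact ⟨k, hk, h⟩
      · exact ⟨n - k, hk.compl (by omega), by omega⟩
    rcases le_or_gt k' k₀ with h | h
    · exact Or.inl ⟨k', h, hk'⟩
    · right
      refine hconcl _ ((hinvariant n k' h.le hkn').trans hmono) ?_
      rintro w ⟨x, hx⟩
      obtain ⟨e, -⟩ := hk'
      refine Finset.mem_filter.2 ⟨Finset.mem_univ _, (e x : Finset (Fin n)), (e x).2, fun z => ?_⟩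
      have hfix : w • ((e x : Set.powersetCard (Fin n) k') : Finset (Fin n)) = e x := by
        rw [← Set.powersetCard.coe_smul, ← map_smul, hx]
      conv_lhs => rw [← hfix]
      exact Finset.smul_mem_smul_finset_iff w
  · right
    -- A prime cycle of length at least `k₀` forces `k₀ ≤ a`. So for small `a` no element with a
    -- fixed point has such a power, and for large `a` the invariant set is rare.
    rcases lt_or_ge a k₀ with h | h
    · refine hconcl _ (hgood.trans hmono) fun w hwx => ?_
      refine Finset.mem_filter.2 ⟨Finset.mem_univ _, fun hY => ?_⟩
      have := (hw w hwx k₀ hY).1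
      omega
    · refine hconcl ((Finset.univ.filter fun σ => ¬ Perm.HasPrimeCyclePower k₀ (n / 2) σ) ∪
        Finset.univ.filter fun σ => ∃ S : Finset (Fin n), S.card = a ∧ ∀ x, σ x ∈ S ↔ x ∈ S)
        ?_ fun w hwx => ?_
      rotate_left
      · by_cases hY : Perm.HasPrimeCyclePower k₀ (n / 2) (w : Perm (Fin n))
        · exact Finset.mem_union_right _ (Finset.mem_filter.2
            ⟨Finset.mem_univ _, (hw w hwx k₀ hY).2⟩)
        · exact Finset.mem_union_left _ (Finset.mem_filter.2 ⟨Finset.mem_univ _, hY⟩)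
      · have h1 := hinvariant n a h ha
        refine (Nat.cast_le.2 (Finset.card_union_le _ _)).trans ?_
        push_cast
        linarith

end Dichotomy

/-! ### Moments of the number of fixed points. -/

section Moments

open MulAction

variable (G Ω : Type*) [Group G] [MulAction G Ω]

variable {G} in
theorem card_fixedBy_prod (Ω' : Type*) [MulAction G Ω'] (w : G) :
    Nat.card (fixedBy (Ω × Ω') w) = Nat.card (fixedBy Ω w) * Nat.card (fixedBy Ω' w) := by
  rw [← Nat.card_prod]
  refine Nat.card_congr ((Equiv.subtypeEquivRight fun x => ?_).trans
    (Equiv.subtypeProdEquivProd (p := fun x => x ∈ fixedBy Ω w)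
      (q := fun x => x ∈ fixedBy Ω' w)))
  simp [mem_fixedBy, Prod.ext_iff]

variable [Fintype G]

theorem sum_sq_mul_fixedPointLaw (J : ℕ) :
    (∑ j ∈ Finset.range J, (j : ℝ) ^ 2 * fixedPointLaw G Ω j) * Nat.card G =
      ∑ w ∈ Finset.univ.filter (fun w : G => Nat.card (fixedBy Ω w) < J),
        (Nat.card (fixedBy Ω w) : ℝ) ^ 2 := by
  classical
  have h0 : (Nat.card G : ℝ) ≠ 0 := by exact_mod_cast Nat.card_pos.ne'
  rw [Finset.sum_mul]
  rw [← Finset.sum_fiberwise_of_maps_to (s := Finset.univ.filter _)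
    (t := Finset.range J) (g := fun w : G => Nat.card (fixedBy Ω w))
    (fun w hw => Finset.mem_range.2 (Finset.mem_filter.1 hw).2)]
  refine Finset.sum_congr rfl fun j hj => ?_
  rw [fixedPointLaw, mul_assoc, div_mul_cancel₀ _ h0, Nat.card_eq_fintype_card,
    Fintype.card_subtype, Finset.filter_filter]
  have : (Finset.univ.filter fun w : G =>
      Nat.card (fixedBy Ω w) < J ∧ Nat.card (fixedBy Ω w) = j) =
      Finset.univ.filter fun w : G => Nat.card (fixedBy Ω w) = j := by
    ext w
    simp only [Finset.mem_filter, Finset.mem_univ, true_and, and_iff_right_iff_imp]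
    rintro rfl
    exact Finset.mem_range.1 hj
  rw [this, Finset.sum_congr rfl (g := fun _ => (j : ℝ) ^ 2), Finset.sum_const, nsmul_eq_mul,
    mul_comm]
  intro w hw
  rw [(Finset.mem_filter.1 hw).2]

variable [Finite Ω]

theorem sum_card_fixedBy : ∑ w : G, Nat.card (fixedBy Ω w) =
    Nat.card (orbitRel.Quotient G Ω) * Nat.card G := by
  classical
  have := Fintype.ofFinite Ω
  have : Fintype (Quotient (orbitRel G Ω)) := Fintype.ofFinite _
  have h := sum_card_fixedBy_eq_card_orbits_mul_card_group G Ω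
  simp only [← Nat.card_eq_fintype_card] at h
  exact h

theorem sum_card_fixedBy_of_isPretransitive [IsPretransitive G Ω] [Nonempty Ω] :
    ∑ w : G, Nat.card (fixedBy Ω w) = Nat.card G := by
  have := (pretransitive_iff_unique_quotient_of_nonempty G Ω).1 inferInstance
  obtain ⟨_⟩ := this
  rw [sum_card_fixedBy, Nat.card_unique, one_mul]

/-- Burnside's lemma on `Ω × Ω`, since fixed points of a product action are pairs of fixed points.
-/
theorem sum_card_fixedBy_sq : ∑ w : G, Nat.card (fixedBy Ω w) ^ 2 =
    actionRank G Ω * Nat.card G := by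
  rw [actionRank, ← sum_card_fixedBy]
  exact Finset.sum_congr rfl fun w _ => by rw [card_fixedBy_prod, sq]

theorem sum_card_fixedBy_cube : ∑ w : G, Nat.card (fixedBy Ω w) ^ 3 =
    Nat.card (orbitRel.Quotient G (Ω × Ω × Ω)) * Nat.card G := by
  rw [← sum_card_fixedBy]
  exact Finset.sum_congr rfl fun w _ => by rw [card_fixedBy_prod, card_fixedBy_prod]; ring

/-- The second moment inequality for the number of fixed points of a transitive group. -/
theorem one_le_mul_actionRank [IsPretransitive G Ω] [Nonempty Ω] :
    1 ≤ (1 - derangementProportion G Ω) * actionRank G Ω := by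
  classical
  set F : G → ℝ := fun w => Nat.card (fixedBy Ω w) with hF
  set A := Finset.univ.filter fun w : G => ∃ x : Ω, w • x = x with hA
  have h1 : ∑ w ∈ A, 1 * F w = Nat.card G := by
    rw [← sum_card_fixedBy_of_isPretransitive G Ω, Nat.cast_sum]
    simp only [one_mul]
    refine Finset.sum_subset (Finset.subset_univ _) fun w _ hw => ?_
    simp only [hA, Finset.mem_filter, Finset.mem_univ, true_and, not_exists] at hw
    have : IsEmpty (fixedBy Ω w) := ⟨fun x => hw x.1 x.2⟩
    change ((Nat.card (fixedBy Ω w) : ℕ) : ℝ) = 0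
    rw [Nat.card_of_isEmpty, Nat.cast_zero]
  have h2 : ∑ w ∈ A, F w ^ 2 ≤ actionRank G Ω * Nat.card G := by
    have h3 : ((∑ w : G, Nat.card (fixedBy Ω w) ^ 2 : ℕ) : ℝ) = actionRank G Ω * Nat.card G := by
      rw [sum_card_fixedBy_sq]
      push_cast
      rfl
    rw [← h3]
    push_cast
    exact Finset.sum_le_sum_of_subset_of_nonneg (Finset.subset_univ _) fun _ _ _ => sq_nonneg _
  have h4 := Finset.sum_mul_sq_le_sq_mul_sq A (fun _ => (1 : ℝ)) F
  rw [h1] at h4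
  have h5 : ∑ w ∈ A, (1 : ℝ) ^ 2 = (1 - derangementProportion G Ω) * Nat.card G := by
    have h0 : (Nat.card G : ℝ) ≠ 0 := by exact_mod_cast Nat.card_pos.ne'
    rw [one_sub_derangementProportion, div_mul_cancel₀ _ h0, Nat.card_eq_fintype_card,
      Fintype.card_subtype]
    simp [hA]
  rw [h5] at h4
  have hG : (0 : ℝ) < Nat.card G := by exact_mod_cast Nat.card_pos
  have hd : 0 ≤ (1 - derangementProportion G Ω) * Nat.card G := by
    rw [← h5]
    positivity
  have h6 := h4.trans (mul_le_mul_of_nonneg_left h2 hd)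
  refine le_of_mul_le_mul_right ?_ (pow_pos hG 2)
  calc 1 * (Nat.card G : ℝ) ^ 2 = (Nat.card G : ℝ) ^ 2 := one_mul _
    _ ≤ _ := h6
    _ = _ := by ring

/-- The truncated second moments of the fixed point law approximate the rank. -/
theorem abs_sum_sq_mul_fixedPointLaw_sub_le {J : ℕ} (hJ : 0 < J) :
    |∑ j ∈ Finset.range J, (j : ℝ) ^ 2 * fixedPointLaw G Ω j - actionRank G Ω| ≤
      Nat.card (orbitRel.Quotient G (Ω × Ω × Ω)) / J := by
  have hG : (0 : ℝ) < Nat.card G := by exact_mod_cast Nat.card_pos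
  have hJ' : (0 : ℝ) < J := by exact_mod_cast hJ
  have h1 := sum_sq_mul_fixedPointLaw G Ω J
  have h2 : (actionRank G Ω : ℝ) * Nat.card G = ∑ w : G, (Nat.card (fixedBy Ω w) : ℝ) ^ 2 := by
    exact_mod_cast (sum_card_fixedBy_sq G Ω).symm
  have h3 : (Nat.card (orbitRel.Quotient G (Ω × Ω × Ω)) : ℝ) * Nat.card G =
      ∑ w : G, (Nat.card (fixedBy Ω w) : ℝ) ^ 3 := by
    exact_mod_cast (sum_card_fixedBy_cube G Ω).symm
  have h4 := Finset.sum_filter_add_sum_filter_not Finset.univ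
    (fun w : G => Nat.card (fixedBy Ω w) < J) (fun w => (Nat.card (fixedBy Ω w) : ℝ) ^ 2)
  set R := ∑ w ∈ Finset.univ.filter (fun w : G => ¬ Nat.card (fixedBy Ω w) < J),
    (Nat.card (fixedBy Ω w) : ℝ) ^ 2 with hR
  have hR0 : 0 ≤ R := Finset.sum_nonneg fun _ _ => sq_nonneg _
  -- Where `F ≥ J`, one has `J * F ^ 2 ≤ F ^ 3`, so the third moment controls the tail.
  have hR1 : R * J ≤ Nat.card (orbitRel.Quotient G (Ω × Ω × Ω)) * Nat.card G := by
    rw [h3, hR, Finset.sum_mul]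
    refine (Finset.sum_le_sum fun w hw => ?_).trans (Finset.sum_le_sum_of_subset_of_nonneg
      (Finset.filter_subset _ _) fun _ _ _ => by positivity)
    have hw' : (J : ℝ) ≤ Nat.card (fixedBy Ω w) := by
      exact_mod_cast not_lt.1 (Finset.mem_filter.1 hw).2
    rw [pow_succ _ 2]
    gcongr
  rw [← h1, ← h2] at h4
  have h5 : actionRank G Ω - ∑ j ∈ Finset.range J, (j : ℝ) ^ 2 * fixedPointLaw G Ω j =
      R / Nat.card G := by
    rw [eq_div_iff hG.ne']
    linarith
  rw [abs_sub_comm, h5, abs_of_nonneg (by positivity), div_le_div_iff₀ hG hJ']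
  exact hR1

end Moments

/-! ### Orbits on pairs and triples of `k`-sets. -/

section KSets

open MulAction Equiv
open scoped Pointwise

variable {n : ℕ} {G : Subgroup (Perm (Fin n))} {Ω : Type*} [MulAction G Ω]

/-- The alternating group is transitive on the colourings of `n` points, with fewer than `n`
colours, having prescribed numbers of points of each colour. -/
theorem exists_alternating_of_card_fiber_eq {T : Type*} [Fintype T] [DecidableEq T]
    (hT : Fintype.card T < n) (c c' : Fin n → T) (o : T)
    (h : ∀ t ≠ o, (Finset.univ.filter fun i => c i = t).card =
      (Finset.univ.filter fun i => c' i = t).card) :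
    ∃ g ∈ alternatingGroup (Fin n), ∀ i, c' (g i) = c i := by
  have hall : ∀ t, (Finset.univ.filter fun i => c i = t).card =
      (Finset.univ.filter fun i => c' i = t).card := by
    have hsum : ∀ c : Fin n → T, ∑ t, (Finset.univ.filter fun i => c i = t).card = n := by
      intro c
      rw [← Finset.card_eq_sum_card_fiberwise (t := Finset.univ) fun _ _ => by simp]
      simp
    intro t
    by_cases ht : t = o
    · subst ht
      have h1 := (hsum c).trans (hsum c').symm
      rw [← Finset.add_sum_erase _ _ (Finset.mem_univ t),
        ← Finset.add_sum_erase (a := t) (s := Finset.univ)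
          (f := fun t => (Finset.univ.filter fun i => c' i = t).card) (Finset.mem_univ t),
        Finset.sum_congr rfl fun s hs => h s (Finset.ne_of_mem_erase hs)] at h1
      exact Nat.add_right_cancel h1
    · exact h t ht
  have e : ∀ t, {i // c i = t} ≃ {i // c' i = t} := fun t => by
    refine Fintype.equivOfCardEq ?_
    rw [Fintype.card_subtype, Fintype.card_subtype, hall t]
  let σ : Perm (Fin n) := Equiv.ofFiberEquiv e
  have hσ : ∀ i, c' (σ i) = c i := Equiv.ofFiberEquiv_map e
  rcases Int.units_eq_one_or (Perm.sign σ) with hs | hs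
  · exact ⟨σ, Perm.mem_alternatingGroup.2 hs, hσ⟩
  -- With fewer colours than points, two points share a colour; swapping them corrects the parity
  -- without affecting the colouring.
  · obtain ⟨i, j, hij, hc⟩ := Fintype.exists_ne_map_eq_of_card_lt c (by simpa using hT)
    refine ⟨σ * swap i j, ?_, fun l => ?_⟩
    · rw [Perm.mem_alternatingGroup, Perm.sign_mul, hs, Perm.sign_swap hij]
      rfl
    · rw [Perm.mul_apply, hσ]
      by_cases hl : l = i
      · rw [hl, swap_apply_left, hc]
      by_cases hl' : l = j
      · rw [hl', swap_apply_right, hc]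
      rw [swap_apply_of_ne_of_ne hl hl']

theorem smul_eq_of_forall_mem_iff {k : ℕ} {e : Ω →[G] Set.powersetCard (Fin n) k}
    (he : Function.Injective e) {g : G} {x y : Ω}
    (h : ∀ i, (g : Perm (Fin n)) i ∈ (e y : Finset (Fin n)) ↔ i ∈ (e x : Finset (Fin n))) :
    g • x = y := by
  apply he
  rw [map_smul]
  apply Subtype.ext
  change g • (e x : Finset (Fin n)) = e y
  ext j
  rw [← Finset.inv_smul_mem_iff, ← h]
  change (g : Perm (Fin n)) ((g : Perm (Fin n))⁻¹ j) ∈ _ ↔ _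
  rw [show (g : Perm (Fin n)) ((g : Perm (Fin n))⁻¹ j) = j from
    (g : Perm (Fin n)).apply_symm_apply j]

theorem card_coe_powersetCard {k : ℕ} (A : Set.powersetCard (Fin n) k) :
    (A : Finset (Fin n)).card = k := A.2

theorem smul_orbit_invariant {k : ℕ} (e : Ω →[G] Set.powersetCard (Fin n) k) (g : G) (x y : Ω) :
    ((e (g • x) : Finset (Fin n)) ∩ e (g • y)).card =
      ((e x : Finset (Fin n)) ∩ e y).card := by
  rw [map_smul, map_smul]
  change (g • (e x : Finset (Fin n)) ∩ g • (e y : Finset (Fin n))).card = _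
  rw [← Finset.smul_finset_inter, Finset.card_smul_finset]

/-- Two pairs of `k`-sets whose intersections have the same size belong to the same orbit. -/
theorem exists_smul_eq_of_card_inter_eq (hG : alternatingGroup (Fin n) ≤ G) (hn : 4 < n) {k : ℕ}
    {e : Ω →[G] Set.powersetCard (Fin n) k} (he : Function.Injective e) {x y x' y' : Ω}
    (h : ((e x : Finset (Fin n)) ∩ e y).card = ((e x' : Finset (Fin n)) ∩ e y').card) :
    ∃ g : G, g • x = x' ∧ g • y = y' := by
  let c : Ω → Ω → Fin n → Bool × Bool := fun x y i =>
    (decide (i ∈ (e x : Finset (Fin n))), decide (i ∈ (e y : Finset (Fin n))))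
  have h1 : ∀ x y : Ω, ((e x : Finset (Fin n)) \ e y).card =
      k - ((e x : Finset (Fin n)) ∩ e y).card := fun x y => by
    rw [Finset.card_sdiff, Finset.inter_comm, card_coe_powersetCard]
  obtain ⟨g, hg, hgc⟩ := exists_alternating_of_card_fiber_eq (T := Bool × Bool) (by simpa using hn)
    (c x y) (c x' y') (false, false) (by
      have htt : ∀ x y, (Finset.univ.filter fun i => c x y i = (true, true)) =
          (e x : Finset (Fin n)) ∩ e y := fun x y => by ext; simp [c]
      have htf : ∀ x y, (Finset.univ.filter fun i => c x y i = (true, false)) =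
          (e x : Finset (Fin n)) \ e y := fun x y => by ext; simp [c]
      have hft : ∀ x y, (Finset.univ.filter fun i => c x y i = (false, true)) =
          (e y : Finset (Fin n)) \ e x := fun x y => by ext; simp [c, and_comm]
      rintro ⟨_ | _, _ | _⟩ ht
      · exact absurd rfl ht
      · rw [hft, hft, h1, h1, Finset.inter_comm, h, Finset.inter_comm]
      · rw [htf, htf, h1, h1, h]
      · rw [htt, htt, h])
  refine ⟨⟨g, hG hg⟩, smul_eq_of_forall_mem_iff he fun i => ?_,
    smul_eq_of_forall_mem_iff he fun i => ?_⟩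
  · exact decide_eq_decide.1 (congrArg Prod.fst (hgc i))
  · exact decide_eq_decide.1 (congrArg Prod.snd (hgc i))

theorem exists_orbit_invariant (hG : alternatingGroup (Fin n) ≤ G) (hn : 4 < n) {k : ℕ}
    {e : Ω →[G] Set.powersetCard (Fin n) k} (he : Function.Injective e) :
    ∃ f : orbitRel.Quotient G (Ω × Ω) → Fin (k + 1), Function.Injective f ∧
      ∀ x y, (f (Quotient.mk _ (x, y)) : ℕ) = ((e x : Finset (Fin n)) ∩ e y).card := by
  refine ⟨Quotient.lift (fun z : Ω × Ω =>
    (⟨((e z.1 : Finset (Fin n)) ∩ e z.2).card, Nat.lt_succ_of_le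
      ((Finset.card_le_card Finset.inter_subset_left).trans_eq (card_coe_powersetCard _))⟩ :
      Fin (k + 1))) ?_, ?_, fun x y => rfl⟩
  · rintro ⟨x, y⟩ ⟨x', y'⟩ h
    obtain ⟨g, hg⟩ := orbitRel_apply.1 h
    obtain ⟨rfl, rfl⟩ := Prod.ext_iff.1 hg
    exact Fin.ext (smul_orbit_invariant e g x' y')
  · rintro ⟨x, y⟩ ⟨x', y'⟩ h
    obtain ⟨g, h1, h2⟩ := exists_smul_eq_of_card_inter_eq hG hn he (Fin.ext_iff.1 h)
    refine (Quotient.sound (orbitRel_apply.2 ⟨g, ?_⟩)).symm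
    exact Prod.ext h1 h2

theorem IsKSetAction.actionRank_le (hG : alternatingGroup (Fin n) ≤ G) (hn : 4 < n) {k : ℕ}
    (h : IsKSetAction G Ω k) : actionRank G Ω ≤ k + 1 := by
  obtain ⟨e, he⟩ := h
  obtain ⟨f, hf, -⟩ := exists_orbit_invariant hG hn he.injective
  simpa [actionRank] using Nat.card_le_card_of_injective f hf

theorem IsKSetAction.actionRank_eq (hG : alternatingGroup (Fin n) ≤ G) (hn : 4 < n) {k : ℕ}
    (hk : 2 * k ≤ n) (h : IsKSetAction G Ω k) : actionRank G Ω = k + 1 := by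
  obtain ⟨e, he⟩ := h
  obtain ⟨f, hf, hfe⟩ := exists_orbit_invariant hG hn he.injective
  have hsurj : Function.Surjective f := by
    intro m
    have hm := m.2
    obtain ⟨A, -, hA⟩ := Finset.exists_subset_card_eq (s := (Finset.univ : Finset (Fin n)))
      (n := k) (by rw [Finset.card_univ, Fintype.card_fin]; omega)
    obtain ⟨M, hMA, hM⟩ := Finset.exists_subset_card_eq (s := A) (n := m) (by omega)
    -- The hypothesis `2 * k ≤ n` leaves room outside `A`, so every intersection size from `0` to
    -- `k` occurs.
    obtain ⟨N, hNA, hN⟩ := Finset.exists_subset_card_eq (s := Aᶜ) (n := k - m)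
      (by rw [Finset.card_compl, Fintype.card_fin]; omega)
    have hdis : Disjoint A N := by
      rw [Finset.disjoint_left]
      exact fun i hi hi' => (Finset.mem_compl.1 (hNA hi')) hi
    have hB : (M ∪ N).card = k := by
      rw [Finset.card_union_of_disjoint (hdis.mono_left hMA)]
      omega
    obtain ⟨x, hx⟩ := he.surjective ⟨A, hA⟩
    obtain ⟨y, hy⟩ := he.surjective ⟨M ∪ N, hB⟩
    refine ⟨Quotient.mk _ (x, y), Fin.ext ?_⟩
    rw [hfe, hx, hy]
    change (A ∩ (M ∪ N)).card = m
    rw [Finset.inter_union_distrib_left, Finset.disjoint_iff_inter_eq_empty.1 hdis,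
      Finset.inter_eq_right.2 hMA, Finset.union_empty, hM]
  simpa [actionRank] using Nat.card_congr (Equiv.ofBijective f ⟨hf, hsurj⟩)

theorem IsKSetAction.card_orbits_triples_le (hG : alternatingGroup (Fin n) ≤ G) (hn : 8 < n)
    {k : ℕ} (h : IsKSetAction G Ω k) :
    Nat.card (orbitRel.Quotient G (Ω × Ω × Ω)) ≤ (k + 1) ^ 8 := by
  obtain ⟨e, he⟩ := h
  let T := Bool × Bool × Bool
  let c : Ω × Ω × Ω → Fin n → T := fun z i => (decide (i ∈ (e z.1 : Finset (Fin n))),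
    decide (i ∈ (e z.2.1 : Finset (Fin n))), decide (i ∈ (e z.2.2 : Finset (Fin n))))
  -- Points outside all three sets may be far more than `k`, but their number follows from the
  -- others. Recording it as `0` keeps all eight entries at most `k`.
  let u : Ω × Ω × Ω → T → ℕ := fun z t => if t = (false, false, false) then 0 else
    (Finset.univ.filter fun i => c z i = t).card
  have hu : ∀ z t, u z t < k + 1 := by
    intro z t
    simp only [u]
    split_ifs with ht
    · exact Nat.succ_pos k
    · refine Nat.lt_succ_of_le ?_
      have key : ∀ x : Ω, (∀ i, c z i = t → i ∈ (e x : Finset (Fin n))) →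
          (Finset.univ.filter fun i => c z i = t).card ≤ k := fun x hx => by
        rw [← card_coe_powersetCard (e x)]
        exact Finset.card_le_card fun i hi => hx i (Finset.mem_filter.1 hi).2
      obtain ⟨a, b, d⟩ := t
      cases a
      · cases b
        · cases d
          · exact absurd rfl ht
          · exact key z.2.2 fun i hi => by simpa [c] using congrArg (fun t : T => t.2.2) hi
        · exact key z.2.1 fun i hi => by simpa [c] using congrArg (fun t : T => t.2.1) hi
      · exact key z.1 fun i hi => by simpa [c] using congrArg (fun t : T => t.1) hi
  let q : Quotient (orbitRel G (Ω × Ω × Ω)) → T → Fin (k + 1) := fun s t => ⟨u s.out t, hu _ t⟩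
  have hq : Function.Injective q := by
    intro s s' hss
    rw [← Quotient.out_eq s, ← Quotient.out_eq s']
    obtain ⟨g, hg, hgc⟩ := exists_alternating_of_card_fiber_eq (T := T) (by simpa [T] using hn)
      (c s.out) (c s'.out) (false, false, false) (by
        intro t ht
        have := Fin.ext_iff.1 (congrFun hss t)
        simpa only [q, u, if_neg ht] using this)
    refine (Quotient.sound (orbitRel_apply.2 ⟨⟨g, hG hg⟩, ?_⟩)).symm
    refine Prod.ext ?_ (Prod.ext ?_ ?_)
    · exact smul_eq_of_forall_mem_iff he.injective fun i =>
        decide_eq_decide.1 (congrArg (fun t : T => t.1) (hgc i))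
    · exact smul_eq_of_forall_mem_iff he.injective fun i =>
        decide_eq_decide.1 (congrArg (fun t : T => t.2.1) (hgc i))
    · exact smul_eq_of_forall_mem_iff he.injective fun i =>
        decide_eq_decide.1 (congrArg (fun t : T => t.2.2) (hgc i))
  have := Nat.card_le_card_of_injective q hq
  simpa [T] using this

end KSets

/-! ### The equivalences and the limit law. -/

theorem derangementProportion_eq_fixedPointLaw_zero (G Ω : Type*) [Group G] [MulAction G Ω]
    [Finite Ω] : derangementProportion G Ω = fixedPointLaw G Ω 0 := by
  rw [derangementProportion, fixedPointLaw]
  congr 2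
  refine Nat.card_congr (Equiv.subtypeEquivRight fun w => ?_)
  rw [Finite.card_eq_zero_iff]
  exact ⟨fun h => ⟨fun x => h x.1 x.2⟩, fun h x hx => h.false ⟨x, hx⟩⟩

theorem PMF.apply_toReal_lt_one {α : Type*} {p : PMF α} {a : α} (h : p ≠ PMF.pure a) :
    (p a).toReal < 1 := by
  have hne : p a ≠ 1 := by
    intro h1
    apply h
    have hs := (p.apply_eq_one_iff a).1 h1
    ext b
    by_cases hb : b = a
    · rw [hb, h1]
      simp
    · rw [(p.apply_eq_zero_iff b).2 (by rw [hs]; exact hb)]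
      simp [hb]
  rw [← ENNReal.toReal_one]
  exact (ENNReal.toReal_lt_toReal (p.apply_ne_top a) ENNReal.one_ne_top).2
    (lt_of_le_of_ne (p.coe_le_one a) hne)

theorem theorem3p3 (n : ℕ → ℕ) (hn : Tendsto n atTop atTop)
    (G : (i : ℕ) → Subgroup (Equiv.Perm (Fin (n i))))
    (hG : ∀ i, G i = ⊤ ∨ G i = alternatingGroup (Fin (n i)))
    (Ω : ℕ → Type*) [∀ i, Finite (Ω i)] [∀ i, MulAction (G i) (Ω i)]
    (hprim : ∀ i, MulAction.IsPreprimitive (G i) (Ω i))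
    (hcard : ∀ i, 3 ≤ Nat.card (Ω i)) :
    List.TFAE [
      Tendsto (fun i => derangementProportion (G i) (Ω i)) atTop (𝓝 1),
      ¬ ∃ k : ℕ, ∃ᶠ i in atTop, IsKSetAction (G i) (Ω i) k,
      Tendsto (fun i => actionRank (G i) (Ω i)) atTop atTop] ∧
    ∀ p : PMF ℕ, p ≠ PMF.pure 0 →
      (∀ j, Tendsto (fun i => fixedPointLaw (G i) (Ω i) j) atTop (𝓝 (p j).toReal)) →
      ∃ k : ℕ, ∀ᶠ i in atTop, IsKSetAction (G i) (Ω i) k := by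
  have hA : ∀ i, alternatingGroup (Fin (n i)) ≤ G i := by
    intro i
    rcases hG i with h | h
    · rw [h]
      exact le_top
    · rw [h]
  have hne : ∀ i, Nonempty (Ω i) := fun i =>
    (Nat.card_pos_iff.1 (lt_of_lt_of_le (by norm_num) (hcard i))).1
  have hdich : ∀ ε > 0, ∃ k₀ : ℕ, ∀ᶠ i in atTop, (∃ k ≤ k₀, IsKSetAction (G i) (Ω i) k) ∨
      1 - derangementProportion (G i) (Ω i) ≤ ε := by
    intro ε hε
    obtain ⟨k₀, n₀, h⟩ := exists_isKSetAction_or_derangementProportion_ge hε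
    refine ⟨k₀, ?_⟩
    filter_upwards [hn.eventually (eventually_ge_atTop n₀)] with i hi
    exact h (n i) hi (G i) (Ω i) (hA i) (hprim i) (hcard i)
  refine ⟨?_, ?_⟩
  · tfae_have 1 → 3 := by
      intro h
      refine tendsto_atTop.2 fun b => ?_
      have hb : (0 : ℝ) < b + 1 := by positivity
      filter_upwards [h.eventually (lt_mem_nhds (show 1 - 1 / ((b : ℝ) + 1) < 1 by
        have : 0 < 1 / ((b : ℝ) + 1) := by positivity
        linarith))] with i hi
      by_contra hlt
      have hrank : (actionRank (G i) (Ω i) : ℝ) ≤ b := by exact_mod_cast (not_le.1 hlt).le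
      have := Fintype.ofFinite (G i)
      have h1 := one_le_mul_actionRank (G i) (Ω i)
      have h2 : (1 - derangementProportion (G i) (Ω i)) * actionRank (G i) (Ω i) ≤
          1 / ((b : ℝ) + 1) * b := by
        refine mul_le_mul (by linarith) hrank (by positivity) (by positivity)
      have h3 : 1 / ((b : ℝ) + 1) * b < 1 := by
        rw [one_div_mul_eq_div, div_lt_one hb]
        linarith
      linarith
    tfae_have 3 → 2 := by
      rintro h ⟨k, hk⟩
      obtain ⟨i, hi, hrank, hni⟩ := (hk.and_eventually ((h.eventually
        (eventually_gt_atTop (k + 1))).and (hn.eventually (eventually_gt_atTop 4)))).exists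
      exact absurd (hi.actionRank_le (hA i) hni) (not_le.2 hrank)
    tfae_have 2 → 1 := by
      intro h
      push Not at h
      rw [Metric.tendsto_nhds]
      intro ε hε
      obtain ⟨k₀, hk₀⟩ := hdich (ε / 2) (half_pos hε)
      -- Only finitely many `k` are in play, so they are eventually all excluded at once.
      have hall : ∀ᶠ i in atTop, ∀ k ∈ Finset.range (k₀ + 1), ¬ IsKSetAction (G i) (Ω i) k :=
        (Finset.eventually_all _).2 fun k _ => h k
      filter_upwards [hk₀, hall] with i hi hi'
      have h1 : 1 - derangementProportion (G i) (Ω i) ≤ ε / 2 := by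
        refine hi.resolve_left ?_
        rintro ⟨k, hk, hkk⟩
        exact hi' k (Finset.mem_range.2 (by omega)) hkk
      have h2 : 0 ≤ 1 - derangementProportion (G i) (Ω i) := by
        rw [one_sub_derangementProportion]
        positivity
      rw [Real.dist_eq, abs_sub_comm, abs_of_nonneg h2]
      linarith
    tfae_finish
  · intro p hp hlim
    have hp0 := PMF.apply_toReal_lt_one hp
    -- Since the derangement proportion tends to `p 0 < 1`, this `ε` eventually rules out the
    -- derangement alternative.
    obtain ⟨k₀, hk₀⟩ := hdich ((1 - (p 0).toReal) / 2) (by linarith)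
    have hlim0 := hlim 0
    simp only [← derangementProportion_eq_fixedPointLaw_zero] at hlim0
    have hpos : (0 : ℝ) < ((k₀ : ℝ) + 1) ^ 8 := by positivity
    -- Triples have at most `(k₀ + 1) ^ 8` orbits, so truncation costs at most `1 / 8`. Another `1 /
    -- 8` from convergence places `k + 1` within `1 / 4` of the fixed number `s`, which determines
    -- `k`.
    set J := 8 * (k₀ + 1) ^ 8 with hJ
    have hJ0 : 0 < J := by positivity
    have hmoment : Tendsto (fun i => ∑ j ∈ Finset.range J,
        (j : ℝ) ^ 2 * fixedPointLaw (G i) (Ω i) j) atTop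
        (𝓝 (∑ j ∈ Finset.range J, (j : ℝ) ^ 2 * (p j).toReal)) :=
      tendsto_finsetSum _ fun j _ => (hlim j).const_mul _
    set s := ∑ j ∈ Finset.range J, (j : ℝ) ^ 2 * (p j).toReal with hs
    have hev : ∀ᶠ i in atTop, ∃ k, IsKSetAction (G i) (Ω i) k ∧ |(k : ℝ) + 1 - s| < 1 / 4 := by
      filter_upwards [hk₀, hlim0.eventually (gt_mem_nhds (show
        (p 0).toReal < (1 + (p 0).toReal) / 2 by linarith)),
        hn.eventually (eventually_gt_atTop 8), hn.eventually (eventually_ge_atTop (2 * k₀)),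
        Metric.tendsto_nhds.1 hmoment (1 / 8) (by norm_num)] with i hi hd hn8 hnk hm
      obtain ⟨k, hk, hkk⟩ := hi.resolve_right (by linarith)
      refine ⟨k, hkk, ?_⟩
      have := Fintype.ofFinite (G i)
      have h1 := abs_sum_sq_mul_fixedPointLaw_sub_le (G i) (Ω i) hJ0
      rw [hkk.actionRank_eq (hA i) (by omega) (by omega)] at h1
      have h2 : (Nat.card (MulAction.orbitRel.Quotient (G i) (Ω i × Ω i × Ω i)) : ℝ) / J ≤
          1 / 8 := by
        have h3 : (Nat.card (MulAction.orbitRel.Quotient (G i) (Ω i × Ω i × Ω i)) : ℝ) ≤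
            ((k₀ : ℝ) + 1) ^ 8 := by
          exact_mod_cast (hkk.card_orbits_triples_le (hA i) hn8).trans
            (Nat.pow_le_pow_left (by omega) 8)
        rw [div_le_div_iff₀ (by exact_mod_cast hJ0) (by norm_num), hJ]
        push_cast
        linarith
      rw [Real.dist_eq, abs_lt] at hm
      have h4 := abs_le.1 (h1.trans h2)
      push_cast at h4
      rw [abs_lt]
      constructor <;> linarith [h4.1, h4.2, hm.1, hm.2]
    obtain ⟨i₀, k, hk, hks⟩ := hev.exists
    refine ⟨k, hev.mono fun i hi => ?_⟩
    obtain ⟨l, hl, hls⟩ := hi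
    have hlk : l = k := by
      rw [abs_lt] at hks hls
      have h1 : (l : ℝ) < k + 1 := by linarith [hks.1, hls.2]
      have h2 : (k : ℝ) < l + 1 := by linarith [hks.2, hls.1]
      have h1' : l < k + 1 := by exact_mod_cast h1
      have h2' : k < l + 1 := by exact_mod_cast h2
      omega
    exact hlk ▸ hl
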